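/- Let $\rho,\sigma$ be positive semidefinite $m\times m$ complex matrices with $\rho\neq0$. Write $\sigma^0$ for the support projection of $\sigma$ and, for $t>0$, $\sigma^{-t}:=(\sigma^{-1})^{t}$, where $\sigma^{-1}$ is the generalized inverse of $\sigma$ (the inverse on its support); likewise for $\rho$. For $\alpha\in[0,\infty)$ and $z\in(0,\infty)$ define $$Q_{\alpha,z}(\rho\|\sigma):=\begin{cases}\mathrm{Tr}\bigl(\rho^{\frac{\alpha}{2z}}\sigma^{\frac{1-\alpha}{z}}\rho^{\frac{\alpha}{2z}}\bigr)^z & \text{if }\alpha\in[0,1]\text{ or }\rho^0\le\sigma^0,\\ +\infty & \text{if }\alpha>1\text{ and }\rho^0\not\le\sigma^0.\end{cases}$$ For $\alpha\ne1$ let $$D_{\alpha,z}(\rho\|\sigma):=\frac1{\alpha-1}\log\frac{Q_{\alpha,z}(\rho\|\sigma)}{\mathrm{Tr}\,\rho}\in[-\infty,+\infty]$$ (with $\log0:=-\infty$ and $\log(+\infty):=+\infty$), and let $D_{1,z}(\rho\|\sigma):=D_1(\rho\|\sigma):=D(\rho\|\sigma)/\mathrm{Tr}\,\rho$, where $D(\rho\|\sigma)$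 is the Umegaki relative entropy: $D(\rho\|\sigma)=\mathrm{Tr}\,\rho(\log\rho-\log\sigma)$ if $\rho^0\le\sigma^0$ (the logarithms being taken on the supports), and $D(\rho\|\sigma)=+\infty$ otherwise. Then the following hold. (i) Assume that $\rho^0$ and $\sigma^0$ are not orthogonal, i.e. $\rho^0\sigma^0\neq0$. Then for any $z>0$ the function $\alpha\mapsto Q_{\alpha,z}(\rho\|\sigma)$ is log-convex on $[0,\infty)$, that is, for all $\alpha_1,\alpha_2\in[0,\infty)$ and $0<\theta<1$, $$Q_{\theta\alpha_1+(1-\theta)\alpha_2,z}(\rho\|\sigma)\le Q_{\alpha_1,z}(\rho\|\sigma)^{\theta}\,Q_{\alpha_2,z}(\rho\|\sigma)^{1-\theta},$$ with the convention $(+\infty)^\theta:=+\infty$. (ii) For any $z>0$ the function $\alpha\mapsto D_{\alpha,z}(\rho\|\sigma)$ is monotone increasing (that is, non-decreasing) on $[0,\infty)$. In particular, for every $\alpha\in[0,1)$ and $\alpha'\in(1,\infty)$, $$D_{\alpha,z}(\rho\|\sigma)\le D_1(\rho\|\sigma)\le D_{\alpha',z}(\rho\|\sigma).$$ -/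

import Mathlib

open scoped ComplexOrder MatrixOrder ENNReal

noncomputable section

namespace AlphaZ

variable {n : Type*} [Fintype n] [DecidableEq n]

/-- The real power `A ^ t` of a positive semidefinite matrix, by functional calculus with
`0 ↦ 0` for every exponent `t`: for `t > 0` it is the usual power, for `t = 0` the support
projection of `A`, and for `t < 0` the power `-t` of the generalized inverse of `A`. -/
def matPow (A : Matrix n n ℂ) (t : ℝ) : Matrix n n ℂ :=
  cfc (fun x : ℝ => if x = 0 then 0 else x ^ t) A

/-- The support projection of a positive semidefinite matrix, usually written `A⁰`. -/
def supp (A : Matrix n n ℂ) : Matrix n n ℂ := matPow A 0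

/-- The (real) trace of a Hermitian matrix. -/
def reTr (A : Matrix n n ℂ) : ℝ := A.trace.re

open Classical in
/-- `Q_{α,z}(ρ‖σ)`, with values in `[0,∞]`. The order on matrices is the Loewner order. -/
def Q (α z : ℝ) (ρ σ : Matrix n n ℂ) : ℝ≥0∞ :=
  if α ≤ 1 ∨ supp ρ ≤ supp σ then
    ENNReal.ofReal (reTr (matPow
      (matPow ρ (α / (2 * z)) * matPow σ ((1 - α) / z) * matPow ρ (α / (2 * z))) z))
  else ⊤

open Classical in
/-- The Umegaki relative entropy: `Tr ρ (log ρ - log σ)` if the support of `ρ` is contained in that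
of `σ`, and `+∞` otherwise. As `Real.log 0 = 0`, both logarithms are taken on the supports. -/
def umegaki (ρ σ : Matrix n n ℂ) : EReal :=
  if supp ρ ≤ supp σ then ((reTr (ρ * (cfc Real.log ρ - cfc Real.log σ)) : ℝ) : EReal) else ⊤

/-- The normalized relative entropy `D₁(ρ‖σ)`. -/
def D₁ (ρ σ : Matrix n n ℂ) : EReal := umegaki ρ σ / ((reTr ρ : ℝ) : EReal)

open Classical in
/-- The α-z-Rényi divergence, with values in `[-∞,∞]`; its value at `α = 1` is `D₁`. Here
`ENNReal.log 0 = -∞` and `ENNReal.log ∞ = ∞`. -/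
def D (α z : ℝ) (ρ σ : Matrix n n ℂ) : EReal :=
  if α = 1 then D₁ ρ σ
  else ((1 / (α - 1) : ℝ) : EReal) * ENNReal.log (Q α z ρ σ / ENNReal.ofReal (reTr ρ))

end AlphaZ

end

noncomputable section

namespace AlphaZ

variable {n : Type*} [Fintype n] [DecidableEq n]

section

open Matrix

/-! ### Functional calculus of Hermitian matrices -/

/-! Put R_α = σ^{(1-α)/2z} ρ^{α/2z} and S_α = R_αᴴ R_α, so that Q is Tr S_α^z wherever it is finite.
If m is the midpoint of a and b, then R_aᴴ R_b = ρ^{a/2z} σ^{(1-m)/z} ρ^{b/2z} is similar to S_m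
through an invertible version of a power of ρ. Midpoint log-convexity is therefore an instance of
`sq_reTr_matPow_le`: (Tr H^z)² ≤ Tr (AᴴA)^z Tr (BᴴB)^z whenever H ≥ 0 is similar to AᴴB.

For z ≥ 1, a unitary triangularisation puts the eigenvalues of H on the diagonal of AᴴB;
Cauchy–Schwarz for entries and for sums, followed by Peierls' inequality, finishes. For z < 1
Peierls' inequality points the wrong way. There Tr H^z is a positive multiple of ∫ log det(1 + xH)
x^{-z-1} dx, the determinant depends only on the similarity class, and |det(1 + AᴴB)|² ≤ det(1 +
AᴴA) det(1 + BᴴB). Continuity in α upgrades midpoint convexity to convexity.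

For monotonicity, suppose first that ρ⁰ ≤ σ⁰. Then Tr S_1^z = Tr ρ, and D is the slope of a secant
through α = 1 of the convex function log Tr S_α^z. That D₁ fits between these slopes needs only a
tangent inequality at 1. The pinched functional `pinchedTr`, built from the diagonal of S_α in the
eigenbasis of ρ, equals Tr ρ at 1, has an explicit derivative there, and lies on one side of Tr
S_α^z by Peierls (`tangent_le_of_touching`). If ρ⁰ ≰ σ⁰, then D = +∞ for α ≥ 1, and for α < 1 the
inequality Tr S_1^z ≤ Tr ρ adds a second non-decreasing term to the secant slope. -/

lemma continuousOn_spectrum (A : Matrix n n ℂ) (f : ℝ → ℝ) : ContinuousOn f (spectrum ℝ A) :=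
  A.finite_real_spectrum.continuousOn f

lemma cfc_eq_conj {A : Matrix n n ℂ} (hA : A.IsHermitian) (f : ℝ → ℝ) :
    cfc f A = (hA.eigenvectorUnitary : Matrix n n ℂ) *
      diagonal (fun i => ((f (hA.eigenvalues i) : ℝ) : ℂ)) *
        star (hA.eigenvectorUnitary : Matrix n n ℂ) := by
  rw [hA.cfc_eq, Matrix.IsHermitian.cfc, Unitary.conjStarAlgAut_apply]
  rfl

lemma reTr_cfc {A : Matrix n n ℂ} (hA : A.IsHermitian) (f : ℝ → ℝ) :
    reTr (cfc f A) = ∑ i, f (hA.eigenvalues i) := by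
  rw [reTr, cfc_eq_conj hA, trace_mul_cycle, Unitary.coe_star_mul_self, one_mul, trace_diagonal]
  simp

lemma cfc_mul_cfc (A : Matrix n n ℂ) (f g : ℝ → ℝ) :
    cfc f A * cfc g A = cfc (fun x => f x * g x) A :=
  (cfc_mul f g A (continuousOn_spectrum A f) (continuousOn_spectrum A g)).symm

lemma isHermitian_cfc (A : Matrix n n ℂ) (f : ℝ → ℝ) : (cfc f A).IsHermitian :=
  cfc_predicate f A

lemma spectrum_nonneg {A : Matrix n n ℂ} (hA : A.PosSemidef) {x : ℝ} (hx : x ∈ spectrum ℝ A) :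
    0 ≤ x := by
  rw [hA.1.spectrum_real_eq_range_eigenvalues] at hx
  obtain ⟨i, rfl⟩ := hx
  exact hA.eigenvalues_nonneg i

lemma cfc_congr_of_posSemidef {A : Matrix n n ℂ} (hA : A.PosSemidef) {f g : ℝ → ℝ}
    (h : ∀ x, 0 ≤ x → f x = g x) : cfc f A = cfc g A :=
  cfc_congr fun x hx => h x (spectrum_nonneg hA hx)

lemma posSemidef_cfc {A : Matrix n n ℂ} (hA : A.PosSemidef) {f : ℝ → ℝ}
    (h : ∀ x, 0 ≤ x → 0 ≤ f x) : (cfc f A).PosSemidef :=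
  nonneg_iff_posSemidef.1 (cfc_nonneg fun x hx => h x (spectrum_nonneg hA hx))

lemma posSemidef_matPow {A : Matrix n n ℂ} (hA : A.PosSemidef) (t : ℝ) :
    (matPow A t).PosSemidef :=
  posSemidef_cfc hA fun x hx => by split_ifs <;> positivity

lemma isHermitian_matPow (A : Matrix n n ℂ) (t : ℝ) : (matPow A t).IsHermitian :=
  isHermitian_cfc A _

lemma matPow_mul_matPow {A : Matrix n n ℂ} (hA : A.PosSemidef) (s t : ℝ) :
    matPow A s * matPow A t = matPow A (s + t) := by
  rw [matPow, matPow, cfc_mul_cfc]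
  refine cfc_congr_of_posSemidef hA fun x hx => ?_
  by_cases h : x = 0
  · simp [h]
  · simp [h, Real.rpow_add (lt_of_le_of_ne hx (Ne.symm h))]

lemma matPow_one {A : Matrix n n ℂ} (hA : A.PosSemidef) : matPow A 1 = A := by
  conv_rhs => rw [← cfc_id ℝ A hA.1]
  refine cfc_congr_of_posSemidef hA fun x hx => ?_
  by_cases h : x = 0 <;> simp [h]

lemma matPow_of_pos (A : Matrix n n ℂ) {t : ℝ} (ht : 0 < t) :
    matPow A t = cfc (fun x : ℝ => x ^ t) A := by
  refine cfc_congr fun x _ => ?_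
  by_cases h : x = 0 <;> simp [h, Real.zero_rpow ht.ne']

lemma reTr_matPow {A : Matrix n n ℂ} (hA : A.IsHermitian) {t : ℝ} (ht : 0 < t) :
    reTr (matPow A t) = ∑ i, hA.eigenvalues i ^ t := by
  rw [matPow_of_pos A ht, reTr_cfc hA]

lemma reTr_matPow_nonneg {A : Matrix n n ℂ} (hA : A.PosSemidef) {t : ℝ} (ht : 0 < t) :
    0 ≤ reTr (matPow A t) := by
  rw [reTr_matPow hA.1 ht]
  exact Finset.sum_nonneg fun i _ => Real.rpow_nonneg (hA.eigenvalues_nonneg i) _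

lemma reTr_matPow_eq_zero {A : Matrix n n ℂ} (hA : A.PosSemidef) {t : ℝ} (ht : 0 < t)
    (h : reTr (matPow A t) = 0) : A = 0 := by
  rw [reTr_matPow hA.1 ht, Finset.sum_eq_zero_iff_of_nonneg
    fun i _ => Real.rpow_nonneg (hA.eigenvalues_nonneg i) _] at h
  rw [← hA.1.eigenvalues_eq_zero_iff]
  ext i
  exact (Real.rpow_eq_zero (hA.eigenvalues_nonneg i) ht.ne').1 (h i (Finset.mem_univ i))

/-- The unit-sum weights `‖(U*V)_{ji}‖²` comparing a matrix's eigenbasis with the columns of `V`. -/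
def weight {A : Matrix n n ℂ} (hA : A.IsHermitian) (V : Matrix n n ℂ) (i j : n) : ℝ :=
  Complex.normSq ((star (hA.eigenvectorUnitary : Matrix n n ℂ) * V) j i)

lemma weight_nonneg {A : Matrix n n ℂ} (hA : A.IsHermitian) (V : Matrix n n ℂ) (i j : n) :
    0 ≤ weight hA V i j := Complex.normSq_nonneg _

/-- The source of Peierls' inequality: for unitary V the weights are doubly stochastic, so Jensen
applies row by row and the column sums restore the trace. -/
lemma conj_cfc_apply_diag {A : Matrix n n ℂ} (hA : A.IsHermitian) (V : Matrix n n ℂ) (f : ℝ → ℝ)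
    (i : n) :
    (star V * cfc f A * V) i i = ((∑ j, weight hA V i j * f (hA.eigenvalues j) : ℝ) : ℂ) := by
  set U := (hA.eigenvectorUnitary : Matrix n n ℂ) with hU
  have : star V * cfc f A * V = star (star U * V) *
      (diagonal (fun i => ((f (hA.eigenvalues i) : ℝ) : ℂ)) * (star U * V)) := by
    rw [cfc_eq_conj hA, star_mul, star_star]
    simp only [Matrix.mul_assoc, hU]
  rw [this, Matrix.mul_apply]
  push_cast
  refine Finset.sum_congr rfl fun j _ => ?_
  rw [diagonal_mul, weight, Complex.normSq_eq_conj_mul_self, star_apply]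
  simp only [Complex.star_def]
  ring

lemma sum_normSq_col {W : Matrix n n ℂ} (hW : star W * W = 1) (i : n) :
    ∑ j, Complex.normSq (W j i) = 1 := by
  have h := congrFun (congrFun hW i) i
  rw [Matrix.mul_apply, one_apply_eq] at h
  have h' : ((∑ j, Complex.normSq (W j i) : ℝ) : ℂ) = 1 := by
    rw [← h]
    push_cast
    exact Finset.sum_congr rfl fun j _ => by
      rw [Complex.normSq_eq_conj_mul_self, star_apply, Complex.star_def]
  exact_mod_cast h'

lemma sum_normSq_row {W : Matrix n n ℂ} (hW : W * star W = 1) (i : n) :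
    ∑ j, Complex.normSq (W i j) = 1 := by
  have := sum_normSq_col (W := star W) (by rwa [star_star]) i
  simpa [star_apply, Complex.star_def] using this

lemma star_mul_mul_star {U V : Matrix n n ℂ} (hU : U * star U = 1) (hV : star V * V = 1) :
    star (star U * V) * (star U * V) = 1 := by
  rw [star_mul, star_star, Matrix.mul_assoc, ← Matrix.mul_assoc U, hU, Matrix.one_mul, hV]

lemma sum_weight_right {A : Matrix n n ℂ} (hA : A.IsHermitian) {V : Matrix n n ℂ}
    (hV : star V * V = 1) (i : n) : ∑ j, weight hA V i j = 1 :=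
  sum_normSq_col (star_mul_mul_star (Unitary.coe_mul_star_self _) hV) i

lemma sum_weight_left {A : Matrix n n ℂ} (hA : A.IsHermitian) {V : Matrix n n ℂ}
    (hV : star V * V = 1) (j : n) : ∑ i, weight hA V i j = 1 :=
  sum_normSq_row (_root_.mul_eq_one_comm.1
    (star_mul_mul_star (Unitary.coe_mul_star_self hA.eigenvectorUnitary) hV)) j

lemma conj_apply_diag {A : Matrix n n ℂ} (hA : A.IsHermitian) (V : Matrix n n ℂ) (i : n) :
    (star V * A * V) i i = ((∑ j, weight hA V i j * hA.eigenvalues j : ℝ) : ℂ) := by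
  have := conj_cfc_apply_diag hA V (fun x => x) i
  have h : cfc (fun x : ℝ => x) A = A := cfc_id' ℝ A hA
  rwa [h] at this

/-- **Peierls' inequality** for the power functions with exponent at least one. -/
lemma peierls_of_one_le {A : Matrix n n ℂ} (hA : A.PosSemidef) {V : Matrix n n ℂ}
    (hV : star V * V = 1) {z : ℝ} (hz : 1 ≤ z) :
    ∑ i, ((star V * A * V) i i).re ^ z ≤ reTr (matPow A z) := by
  rw [reTr_matPow hA.1 (by linarith)]
  calc ∑ i, ((star V * A * V) i i).re ^ z
      ≤ ∑ i, ∑ j, weight hA.1 V i j * hA.1.eigenvalues j ^ z := by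
        refine Finset.sum_le_sum fun i _ => ?_
        rw [conj_apply_diag hA.1, Complex.ofReal_re]
        exact (convexOn_rpow hz).map_sum_le (fun j _ => weight_nonneg hA.1 V i j)
          (sum_weight_right hA.1 hV i) fun j _ => hA.eigenvalues_nonneg j
    _ = _ := by
        rw [Finset.sum_comm]
        exact Finset.sum_congr rfl fun j _ => by
          rw [← Finset.sum_mul, sum_weight_left hA.1 hV, one_mul]

/-- **Peierls' inequality** for the power functions with exponent at most one. -/
lemma peierls_of_le_one {A : Matrix n n ℂ} (hA : A.PosSemidef) {V : Matrix n n ℂ}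
    (hV : star V * V = 1) {z : ℝ} (hz : 0 < z) (hz1 : z ≤ 1) :
    reTr (matPow A z) ≤ ∑ i, ((star V * A * V) i i).re ^ z := by
  rw [reTr_matPow hA.1 hz]
  calc _ = ∑ i, ∑ j, weight hA.1 V i j * hA.1.eigenvalues j ^ z := by
        rw [Finset.sum_comm]
        exact Finset.sum_congr rfl fun j _ => by
          rw [← Finset.sum_mul, sum_weight_left hA.1 hV, one_mul]
    _ ≤ ∑ i, ((star V * A * V) i i).re ^ z := by
        refine Finset.sum_le_sum fun i _ => ?_
        rw [conj_apply_diag hA.1, Complex.ofReal_re]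
        exact (Real.concaveOn_rpow hz.le hz1).le_map_sum (fun j _ => weight_nonneg hA.1 V i j)
          (sum_weight_right hA.1 hV i) fun j _ => hA.eigenvalues_nonneg j

lemma conj_eigenvectorUnitary_apply_diag {A : Matrix n n ℂ} (hA : A.IsHermitian) (i : n) :
    (star (hA.eigenvectorUnitary : Matrix n n ℂ) * A * (hA.eigenvectorUnitary : Matrix n n ℂ)) i i
      = ((hA.eigenvalues i : ℝ) : ℂ) := by
  rw [conj_apply_diag hA]
  simp [weight, Matrix.one_apply, apply_ite Complex.normSq]

/-- Trace functions with power kernel are monotone in the Loewner order. -/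
lemma reTr_matPow_mono {A B : Matrix n n ℂ} (hA : A.PosSemidef) (hB : B.PosSemidef) (hAB : A ≤ B)
    {z : ℝ} (hz : 0 < z) : reTr (matPow A z) ≤ reTr (matPow B z) := by
  have key : ∀ (V : Matrix n n ℂ) (i : n),
      ((star V * A * V) i i).re ^ z ≤ ((star V * B * V) i i).re ^ z := fun V i => by
    have h1 := (hA.conjTranspose_mul_mul_same V).diag_nonneg (i := i)
    have h2 := ((le_iff.1 hAB).conjTranspose_mul_mul_same V).diag_nonneg (i := i)
    rw [Matrix.mul_sub, Matrix.sub_mul, Matrix.sub_apply, sub_nonneg] at h2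
    exact Real.rpow_le_rpow (Complex.le_def.1 h1).1 (Complex.le_def.1 h2).1 hz.le
  -- Peierls is an equality in a matrix's own eigenbasis. The eigenbasis of A is used for z ≥ 1 and
  -- that of B for z ≤ 1, so that the inequality for the other matrix has the right direction.
  rcases le_total 1 z with h | h
  · calc reTr (matPow A z) = ∑ i, ((star (hA.1.eigenvectorUnitary : Matrix n n ℂ) * A *
          (hA.1.eigenvectorUnitary : Matrix n n ℂ)) i i).re ^ z := by
          rw [reTr_matPow hA.1 hz]
          exact Finset.sum_congr rfl fun i _ => by
            rw [conj_eigenvectorUnitary_apply_diag, Complex.ofReal_re]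
      _ ≤ _ := Finset.sum_le_sum fun i _ => key _ i
      _ ≤ _ := peierls_of_one_le hB (Unitary.coe_star_mul_self _) h
  · calc reTr (matPow A z) ≤ ∑ i, ((star (hB.1.eigenvectorUnitary : Matrix n n ℂ) * A *
          (hB.1.eigenvectorUnitary : Matrix n n ℂ)) i i).re ^ z :=
          peierls_of_le_one hA (Unitary.coe_star_mul_self _) hz h
      _ ≤ _ := Finset.sum_le_sum fun i _ => key _ i
      _ = reTr (matPow B z) := by
          rw [reTr_matPow hB.1 hz]
          exact Finset.sum_congr rfl fun i _ => by
            rw [conj_eigenvectorUnitary_apply_diag, Complex.ofReal_re]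

end

section

open Matrix MeasureTheory Set

/-! ### Determinant inequalities -/

lemma det_one_add_smul {H : Matrix n n ℂ} (hH : H.IsHermitian) (x : ℝ) :
    (1 + (x : ℂ) • H).det = ((∏ i, (1 + x * hH.eigenvalues i) : ℝ) : ℂ) := by
  set U := (hH.eigenvectorUnitary : Matrix n n ℂ) with hU
  have hUU : U * star U = 1 := Unitary.coe_mul_star_self _
  have h : 1 + (x : ℂ) • H =
      U * diagonal (fun i => ((1 + x * hH.eigenvalues i : ℝ) : ℂ)) * star U := by
    have h1 : H = U * diagonal (fun i => ((hH.eigenvalues i : ℝ) : ℂ)) * star U := by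
      have := cfc_eq_conj hH (fun x => x)
      have h0 : cfc (fun x : ℝ => x) H = H := cfc_id' ℝ H hH
      rwa [h0] at this
    have h2 : diagonal (fun i => ((1 + x * hH.eigenvalues i : ℝ) : ℂ)) =
        1 + (x : ℂ) • diagonal (fun i => ((hH.eigenvalues i : ℝ) : ℂ)) := by
      rw [← diagonal_one, ← diagonal_smul, diagonal_add]
      simp
    rw [h2, Matrix.mul_add, Matrix.add_mul, Matrix.mul_one, hUU, Matrix.mul_smul,
      Matrix.smul_mul, ← h1]
  rw [h, det_mul_right_comm, hUU, Matrix.one_mul, det_diagonal]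
  push_cast
  rfl

lemma one_le_det_one_add {H : Matrix n n ℂ} (hH : H.PosSemidef) : 1 ≤ (1 + H).det := by
  have := det_one_add_smul hH.1 1
  rw [Complex.ofReal_one, one_smul] at this
  rw [this, ← Complex.ofReal_one, Complex.real_le_real]
  have := Finset.prod_le_prod (s := Finset.univ) (f := fun _ : n => (1 : ℝ))
    (g := fun i => 1 + 1 * hH.1.eigenvalues i) (fun _ _ => zero_le_one)
    fun i _ => by linarith [hH.eigenvalues_nonneg i]
  simpa using this

/-- For invertible K with square root T, K + S = T (1 + T⁻¹ S T⁻¹) T, and the middle factor has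
determinant at least 1. -/
lemma det_le_det_add {K S : Matrix n n ℂ} (hK : K.PosSemidef) (hS : S.PosSemidef) :
    K.det ≤ (K + S).det := by
  by_cases h : K.det = 0
  · rw [h]
    exact (hK.add hS).det_nonneg
  set T := matPow K (1 / 2) with hT
  have hTT : T * T = K := by
    rw [hT, matPow_mul_matPow hK, add_halves, matPow_one hK]
  have hTu : IsUnit T.det := by
    rw [isUnit_iff_ne_zero]
    intro h0
    rw [← hTT, det_mul, h0, zero_mul] at h
    exact h rfl
  have hTH : Tᴴ = T := isHermitian_matPow K _
  have hTi : (T⁻¹)ᴴ = T⁻¹ := by rw [conjTranspose_nonsing_inv, hTH]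
  have h1 : K + S = T * (1 + T⁻¹ * S * T⁻¹) * T := by
    rw [Matrix.mul_add, Matrix.add_mul, Matrix.mul_one, hTT, Matrix.mul_assoc T⁻¹,
      Matrix.mul_nonsing_inv_cancel_left _ _ hTu, Matrix.nonsing_inv_mul_cancel_right _ _ hTu]
  have h2 : (T⁻¹ * S * T⁻¹).PosSemidef := by
    simpa only [hTi] using hS.conjTranspose_mul_mul_same T⁻¹
  have h3 : (K + S).det = K.det * (1 + T⁻¹ * S * T⁻¹).det := by
    rw [h1, ← hTT, det_mul, det_mul, det_mul]
    ring
  rw [h3]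
  exact le_mul_of_one_le_right hK.det_nonneg (one_le_det_one_add h2)

/-- A Cauchy–Schwarz inequality for determinants. -/
lemma norm_det_one_add_sq_le (A B : Matrix n n ℂ) :
    ‖(1 + Aᴴ * B).det‖ ^ 2 ≤ (1 + Aᴴ * A).det.re * (1 + Bᴴ * B).det.re := by
  set P := 1 + Aᴴ * A with hP
  set R := 1 + Bᴴ * B with hR
  set C := 1 + Aᴴ * B with hC
  have hPd : P.PosDef := PosDef.one.add_posSemidef (posSemidef_conjTranspose_mul_self A)
  -- This is the Gram matrix of the block columns (1, A) and (1, B). Its Schur complement gives Cᴴ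
  -- P⁻¹ C ≤ R, and determinants are then compared.
  have hblock : (fromBlocks P C Cᴴ R).PosSemidef := by
    have : fromBlocks P C Cᴴ R = (fromBlocks 1 1 A B)ᴴ * fromBlocks 1 1 A B := by
      rw [fromBlocks_conjTranspose, fromBlocks_multiply]
      simp [hP, hC, hR]
    rw [this]
    exact posSemidef_conjTranspose_mul_self _
  have hPu : IsUnit P := hPd.isUnit
  let _ := hPu.invertible
  have hS := (PosDef.fromBlocks₁₁ C R hPd).1 hblock
  have hK : (Cᴴ * P⁻¹ * C).PosSemidef := hPd.posSemidef.inv.conjTranspose_mul_mul_same C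
  have hle := det_le_det_add hK hS
  rw [add_sub_cancel, det_mul, det_mul, det_conjTranspose, det_nonsing_inv,
    Ring.inverse_eq_inv'] at hle
  have hPpos := hPd.det_pos
  obtain ⟨hp, hpi⟩ := Complex.lt_def.1 hPpos
  have hPre : P.det = ((P.det.re : ℝ) : ℂ) := Complex.ext (by simp) (by simpa using hpi.symm)
  have h1 : star C.det * P.det⁻¹ * C.det = ((‖C.det‖ ^ 2 / P.det.re : ℝ) : ℂ) := by
    rw [hPre]
    push_cast
    rw [← Complex.conj_mul', Complex.star_def]
    simp only [Complex.ofReal_re]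
    ring
  rw [h1] at hle
  have := (Complex.le_def.1 hle).1
  rw [Complex.ofReal_re, div_le_iff₀ (by simpa using hp)] at this
  linarith

/-! ### An integral representation of powers -/

/-- Near 0, log (1 + y) ≤ y leaves y^{-z}, integrable as z < 1. Near infinity, log (1 + y) is
bounded by a multiple of y^{z/2}, which leaves y^{-z/2-1}. -/
lemma integrableOn_log_mul_rpow {z : ℝ} (hz : 0 < z) (hz1 : z < 1) :
    IntegrableOn (fun y : ℝ => Real.log (1 + y) * y ^ (-z - 1)) (Ioi 0) := by
  have hmeas : Measurable fun y : ℝ => Real.log (1 + y) * y ^ (-z - 1) := by fun_prop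
  rw [← Ioc_union_Ioi_eq_Ioi zero_le_one]
  refine IntegrableOn.union ?_ ?_
  · have h : IntegrableOn (fun y : ℝ => y ^ (-z)) (Ioc 0 1) :=
      (intervalIntegrable_iff_integrableOn_Ioc_of_le zero_le_one).1
        (intervalIntegral.intervalIntegrable_rpow' (by linarith))
    refine h.mono' hmeas.aestronglyMeasurable ?_
    filter_upwards [ae_restrict_mem measurableSet_Ioc] with y hy
    have hl : 0 ≤ Real.log (1 + y) := Real.log_nonneg (by linarith [hy.1])
    rw [Real.norm_of_nonneg (mul_nonneg hl (Real.rpow_nonneg hy.1.le _))]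
    calc Real.log (1 + y) * y ^ (-z - 1) ≤ y * y ^ (-z - 1) := by
          refine mul_le_mul_of_nonneg_right ?_ (Real.rpow_nonneg hy.1.le _)
          linarith [Real.log_le_sub_one_of_pos (show 0 < 1 + y by linarith [hy.1])]
      _ = y ^ (-z) := by
          rw [mul_comm, ← Real.rpow_add_one hy.1.ne']
          ring_nf
  · have h : IntegrableOn (fun y : ℝ => 2 ^ (z / 2) / (z / 2) * y ^ (-(z / 2) - 1)) (Ioi 1) :=
      (integrableOn_Ioi_rpow_of_lt (by linarith) one_pos).const_mul _
    refine h.mono' hmeas.aestronglyMeasurable ?_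
    filter_upwards [ae_restrict_mem measurableSet_Ioi] with y hy
    have hy : 1 < y := hy
    have hl : 0 ≤ Real.log (1 + y) := Real.log_nonneg (by linarith)
    rw [Real.norm_of_nonneg (mul_nonneg hl (Real.rpow_nonneg (by linarith) _))]
    calc Real.log (1 + y) * y ^ (-z - 1)
        ≤ (2 ^ (z / 2) * y ^ (z / 2) / (z / 2)) * y ^ (-z - 1) := by
          gcongr
          refine (Real.log_le_rpow_div (by linarith) (half_pos hz)).trans ?_
          rw [← Real.mul_rpow (by norm_num) (by linarith)]
          gcongr
          linarith
      _ = 2 ^ (z / 2) / (z / 2) * (y ^ (z / 2) * y ^ (-z - 1)) := by ring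
      _ = _ := by
          rw [← Real.rpow_add (by linarith)]
          ring_nf

/-- The constant `∫₀^∞ log (1 + y) y ^ (-z - 1) dy`. -/
def logConst (z : ℝ) : ℝ := ∫ y in Ioi (0 : ℝ), Real.log (1 + y) * y ^ (-z - 1)

lemma logConst_pos {z : ℝ} (hz : 0 < z) (hz1 : z < 1) : 0 < logConst z := by
  have hpos : ∀ y ∈ Ioi (0 : ℝ), 0 < Real.log (1 + y) * y ^ (-z - 1) := fun y hy =>
    mul_pos (Real.log_pos (by linarith [mem_Ioi.1 hy])) (Real.rpow_pos_of_pos hy _)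
  rw [logConst, setIntegral_pos_iff_support_of_nonneg_ae]
  · refine lt_of_lt_of_le ?_ (measure_mono (s := Ioi (0 : ℝ)) fun y hy => ⟨(hpos y hy).ne', hy⟩)
    simp
  · filter_upwards [ae_restrict_mem measurableSet_Ioi] with y hy using (hpos y hy).le
  · exact integrableOn_log_mul_rpow hz hz1

lemma log_one_add_mul_mul_rpow {z l x : ℝ} (hl : 0 < l) (hx : 0 < x) :
    Real.log (1 + x * l) * x ^ (-z - 1) =
      l ^ (z + 1) * (Real.log (1 + l * x) * (l * x) ^ (-z - 1)) := by
  rw [Real.mul_rpow hl.le hx.le, mul_comm x l]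
  have : l ^ (z + 1) * l ^ (-z - 1) = 1 := by
    rw [← Real.rpow_add hl]
    simp
  linear_combination (-Real.log (1 + l * x) * x ^ (-z - 1)) * this

lemma integrableOn_log_one_add_mul {z l : ℝ} (hz : 0 < z) (hz1 : z < 1) (hl : 0 ≤ l) :
    IntegrableOn (fun x : ℝ => Real.log (1 + x * l) * x ^ (-z - 1)) (Ioi 0) := by
  rcases hl.eq_or_lt with rfl | hl
  · simp
  refine IntegrableOn.congr_fun (f := fun x =>
    l ^ (z + 1) * (Real.log (1 + l * x) * (l * x) ^ (-z - 1))) ?_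
    (fun x hx => (log_one_add_mul_mul_rpow hl hx).symm) measurableSet_Ioi
  have := (integrableOn_Ioi_comp_mul_left_iff
    (fun y : ℝ => Real.log (1 + y) * y ^ (-z - 1)) 0 hl).2
    (by simpa using integrableOn_log_mul_rpow hz hz1)
  exact this.const_mul _

lemma integral_log_one_add_mul {z l : ℝ} (hz : 0 < z) (hl : 0 ≤ l) :
    ∫ x in Ioi (0 : ℝ), Real.log (1 + x * l) * x ^ (-z - 1) = l ^ z * logConst z := by
  rcases hl.eq_or_lt with rfl | hl
  · simp [Real.zero_rpow hz.ne']
  rw [setIntegral_congr_fun measurableSet_Ioi fun x hx => log_one_add_mul_mul_rpow hl hx,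
    integral_const_mul, integral_comp_mul_left_Ioi
      (fun y : ℝ => Real.log (1 + y) * y ^ (-z - 1)) 0 hl, mul_zero, smul_eq_mul, ← mul_assoc,
    Real.rpow_add_one hl.ne', logConst]
  field_simp

/-- The log-determinant is the sum of log (1 + xλ) over the eigenvalues λ, and the substitution y =
λx turns each integral into λ^z times the constant. -/
lemma integral_log_det {z : ℝ} (hz : 0 < z) (hz1 : z < 1) {H : Matrix n n ℂ}
    (hH : H.PosSemidef) :
    IntegrableOn (fun x : ℝ => Real.log (1 + (x : ℂ) • H).det.re * x ^ (-z - 1)) (Ioi 0) ∧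
    ∫ x in Ioi (0 : ℝ), Real.log (1 + (x : ℂ) • H).det.re * x ^ (-z - 1) =
      reTr (matPow H z) * logConst z := by
  have h : EqOn (fun x : ℝ => ∑ i, Real.log (1 + x * hH.1.eigenvalues i) * x ^ (-z - 1))
      (fun x : ℝ => Real.log (1 + (x : ℂ) • H).det.re * x ^ (-z - 1)) (Ioi 0) := fun x hx => by
    simp only
    rw [det_one_add_smul hH.1, Complex.ofReal_re, Real.log_prod, Finset.sum_mul]
    intro i _
    have := mul_nonneg (le_of_lt hx) (hH.eigenvalues_nonneg i)
    positivity
  have hi : ∀ i, IntegrableOn (fun x : ℝ =>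
      Real.log (1 + x * hH.1.eigenvalues i) * x ^ (-z - 1)) (Ioi 0) := fun i =>
    integrableOn_log_one_add_mul hz hz1 (hH.eigenvalues_nonneg i)
  refine ⟨IntegrableOn.congr_fun (integrable_finsetSum _ fun i _ => hi i) h measurableSet_Ioi, ?_⟩
  rw [← setIntegral_congr_fun measurableSet_Ioi h, integral_finsetSum _ fun i _ => hi i,
    reTr_matPow hH.1 hz, Finset.sum_mul]
  exact Finset.sum_congr rfl fun i _ => integral_log_one_add_mul hz (hH.eigenvalues_nonneg i)

/-- The determinant Cauchy–Schwarz inequality for √x A and √x B is integrated after taking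
logarithms. This gives only an arithmetic mean on the right; rescaling A and B later turns it into a
geometric one. -/
lemma reTr_matPow_le_of_det_eq {z : ℝ} (hz : 0 < z) (hz1 : z < 1) {H A B : Matrix n n ℂ}
    (hH : H.PosSemidef)
    (h : ∀ x : ℝ, 0 < x → (1 + (x : ℂ) • H).det = (1 + (x : ℂ) • (Aᴴ * B)).det) :
    2 * reTr (matPow H z) ≤ reTr (matPow (Aᴴ * A) z) + reTr (matPow (Bᴴ * B) z) := by
  have hA := posSemidef_conjTranspose_mul_self A
  have hB := posSemidef_conjTranspose_mul_self B
  obtain ⟨iH, eH⟩ := integral_log_det hz hz1 hH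
  obtain ⟨iA, eA⟩ := integral_log_det hz hz1 hA
  obtain ⟨iB, eB⟩ := integral_log_det hz hz1 hB
  have hC := logConst_pos hz hz1
  refine le_of_mul_le_mul_right ?_ hC
  rw [add_mul, mul_assoc, ← eH, ← eA, ← eB, ← integral_const_mul, ← integral_add iA iB]
  refine setIntegral_mono_on (iH.const_mul 2) (iA.add iB) measurableSet_Ioi fun x hx => ?_
  have hx : 0 < x := hx
  have hpos : ∀ {K : Matrix n n ℂ}, K.PosSemidef → 0 < (1 + (x : ℂ) • K).det.re := fun {K} hK => by
    rw [det_one_add_smul hK.1, Complex.ofReal_re]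
    refine Finset.prod_pos fun i _ => ?_
    have := mul_nonneg hx.le (hK.eigenvalues_nonneg i)
    positivity
  have hs : ∀ C D : Matrix n n ℂ, (((Real.sqrt x : ℝ) : ℂ) • C)ᴴ * (((Real.sqrt x : ℝ) : ℂ) • D) =
      (x : ℂ) • (Cᴴ * D) := fun C D => by
    rw [conjTranspose_smul, Matrix.smul_mul, Matrix.mul_smul, smul_smul, Complex.star_def,
      Complex.conj_ofReal, ← Complex.ofReal_mul, Real.mul_self_sqrt hx.le]
  have key := norm_det_one_add_sq_le (((Real.sqrt x : ℝ) : ℂ) • A) (((Real.sqrt x : ℝ) : ℂ) • B)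
  rw [hs, hs, hs, ← h x hx] at key
  have h2 : 2 * Real.log (1 + (x : ℂ) • H).det.re ≤
      Real.log (1 + (x : ℂ) • (Aᴴ * A)).det.re + Real.log (1 + (x : ℂ) • (Bᴴ * B)).det.re := by
    rw [← Real.log_mul (hpos hA).ne' (hpos hB).ne']
    refine le_trans ?_ (Real.log_le_log (pow_pos ?_ 2) key)
    · rw [Real.log_pow, Nat.cast_ofNat]
      have := Real.log_le_log (hpos hH) (Complex.re_le_norm _)
      linarith
    · exact (hpos hH).trans_le (Complex.re_le_norm _)
  have hxp : 0 ≤ x ^ (-z - 1) := Real.rpow_nonneg hx.le _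
  have := mul_le_mul_of_nonneg_right h2 hxp
  linarith

/-! ### Homogeneity, and the passage from the arithmetic to the geometric mean. -/

lemma matPow_smul {A : Matrix n n ℂ} (hA : A.PosSemidef) {c : ℝ} (hc : 0 ≤ c) {t : ℝ}
    (ht : 0 < t) : matPow ((c : ℂ) • A) t = ((c ^ t : ℝ) : ℂ) • matPow A t := by
  have h1 : cfc (fun x : ℝ => c * x) A = (c : ℂ) • A := by
    have := cfc_const_mul_id c A hA.1
    rw [this]
    ext i j
    simp
  have h2 : ((c ^ t : ℝ) : ℂ) • matPow A t = cfc (fun x : ℝ => c ^ t * x ^ t) A := by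
    rw [matPow_of_pos A ht, cfc_const_mul _ _ _ (continuousOn_spectrum A _)]
    ext i j
    simp
  have h3 : cfc (fun x : ℝ => (c * x) ^ t) A = cfc (fun x : ℝ => x ^ t)
      (cfc (fun x : ℝ => c * x) A) :=
    cfc_comp' (fun x : ℝ => x ^ t) (fun x : ℝ => c * x) A
      ((A.finite_real_spectrum.image _).continuousOn _) (continuousOn_spectrum A _) hA.1
  rw [h2, ← h1, matPow_of_pos _ ht, ← h3]
  exact cfc_congr_of_posSemidef hA fun x hx => Real.mul_rpow hc hx

lemma reTr_matPow_smul {A : Matrix n n ℂ} (hA : A.PosSemidef) {c : ℝ} (hc : 0 ≤ c) {t : ℝ}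
    (ht : 0 < t) : reTr (matPow ((c : ℂ) • A) t) = c ^ t * reTr (matPow A t) := by
  rw [matPow_smul hA hc ht, reTr, reTr, trace_smul, smul_eq_mul, Complex.re_ofReal_mul]

lemma sq_le_mul_of_forall_scaling {h a b : ℝ} (hh : 0 ≤ h) (ha : 0 ≤ a) (hb : 0 ≤ b)
    (H : ∀ c : ℝ, 0 < c → 2 * h ≤ c * a + c⁻¹ * b) : h ^ 2 ≤ a * b := by
  rcases hh.eq_or_lt with rfl | hh
  · simpa using mul_nonneg ha hb
  rcases ha.eq_or_lt with rfl | ha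
  -- For a = 0 this c gives 2h ≤ hb / (b + 1) < h, a contradiction.
  · have := H ((b + 1) / h) (by positivity)
    rw [inv_div, mul_zero, zero_add, div_mul_eq_mul_div, le_div_iff₀ (by positivity)] at this
    nlinarith
  -- The choice c = h / a makes the first term h. The optimal c = √(b / a) would need b = 0 to be
  -- treated apart.
  have := H (h / a) (by positivity)
  rw [inv_div, div_mul_cancel₀ _ ha.ne', div_mul_eq_mul_div] at this
  have h3 : h ≤ a * b / h := by linarith
  rw [le_div_iff₀ hh] at h3
  nlinarith

lemma sq_reTr_matPow_le_of_det_eq {z : ℝ} (hz : 0 < z) (hz1 : z < 1) {H A B : Matrix n n ℂ}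
    (hH : H.PosSemidef)
    (h : ∀ x : ℝ, 0 < x → (1 + (x : ℂ) • H).det = (1 + (x : ℂ) • (Aᴴ * B)).det) :
    reTr (matPow H z) ^ 2 ≤ reTr (matPow (Aᴴ * A) z) * reTr (matPow (Bᴴ * B) z) := by
  have hA := posSemidef_conjTranspose_mul_self A
  have hB := posSemidef_conjTranspose_mul_self B
  refine sq_le_mul_of_forall_scaling (reTr_matPow_nonneg hH hz) (reTr_matPow_nonneg hA hz)
    (reTr_matPow_nonneg hB hz) fun c hc => ?_
  -- Replacing A by dA and B by d⁻¹B keeps AᴴB and multiplies the two traces by c and c⁻¹, since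
  -- (d²)^z = c.
  set d : ℝ := c ^ (1 / (2 * z)) with hd
  have hd0 : 0 < d := Real.rpow_pos_of_pos hc _
  have hdz : (d ^ 2) ^ z = c := by
    rw [← Real.rpow_natCast, ← Real.rpow_mul hd0.le, hd, ← Real.rpow_mul hc.le]
    have : 1 / (2 * z) * (((2 : ℕ) : ℝ) * z) = 1 := by
      push_cast
      field_simp
    rw [this, Real.rpow_one]
  have hs : ∀ (r s : ℝ) (C D : Matrix n n ℂ), ((r : ℂ) • C)ᴴ * ((s : ℂ) • D) =
      ((r * s : ℝ) : ℂ) • (Cᴴ * D) := fun r s C D => by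
    rw [conjTranspose_smul, Matrix.smul_mul, Matrix.mul_smul, smul_smul, Complex.star_def,
      Complex.conj_ofReal, ← Complex.ofReal_mul]
  have key := reTr_matPow_le_of_det_eq hz hz1 (A := (d : ℂ) • A) (B := ((d⁻¹ : ℝ) : ℂ) • B) hH
    (fun x hx => by
      rw [h x hx, hs, mul_inv_cancel₀ hd0.ne', Complex.ofReal_one, one_smul])
  rwa [hs, hs, reTr_matPow_smul hA (by positivity) hz, reTr_matPow_smul hB (by positivity) hz,
    ← mul_inv, Real.inv_rpow (by positivity), ← pow_two, hdz] at key

end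

section

open Matrix Set

/-! ### Schur triangularisation of diagonalisable matrices -/

-- Gram–Schmidt preserves initial spans. Hence T - d i maps the span of the first vectors, up to
-- index i, into that of the strictly earlier ones, which is orthogonal to the i-th orthonormal
-- vector: T becomes triangular with the eigenvalues on its diagonal.
open InnerProductSpace Submodule in
lemma inner_gramSchmidtNormed_eigenvector {E ι : Type*} [NormedAddCommGroup E]
    [InnerProductSpace ℂ E] [LinearOrder ι] [LocallyFiniteOrderBot ι] [WellFoundedLT ι]
    (T : E →ₗ[ℂ] E) {v : ι → E} (hv : LinearIndependent ℂ v) {d : ι → ℂ}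
    (hT : ∀ i, T (v i) = d i • v i) (i : ι) :
    inner ℂ (gramSchmidtNormed ℂ v i) (T (gramSchmidtNormed ℂ v i)) = d i := by
  set e := gramSchmidtNormed ℂ v i with he
  have hnorm : ‖e‖ = 1 := gramSchmidtNormed_unit_length i hv
  have hmem : e ∈ span ℂ (v '' Iic i) := by
    rw [← span_gramSchmidt_Iic ℂ v i, he, gramSchmidtNormed]
    exact smul_mem _ _ (subset_span ⟨i, mem_Iic.2 le_rfl, rfl⟩)
  have hlow : ∀ w ∈ span ℂ (v '' Iic i), T w - d i • w ∈ span ℂ (v '' Iio i) := by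
    intro w hw
    induction hw using span_induction with
    | mem x hx =>
      obtain ⟨j, hj, rfl⟩ := hx
      rw [hT, ← sub_smul]
      rcases (mem_Iic.1 hj).eq_or_lt with rfl | hlt
      · simp
      · exact smul_mem _ _ (subset_span ⟨j, hlt, rfl⟩)
    | zero => simp
    | add x y _ _ hx hy =>
      have : T (x + y) - d i • (x + y) = (T x - d i • x) + (T y - d i • y) := by
        rw [map_add, smul_add]
        abel
      rw [this]
      exact add_mem hx hy
    | smul a x _ hx =>
      have : T (a • x) - d i • (a • x) = a • (T x - d i • x) := by
        rw [map_smul, smul_sub, smul_comm]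
      rw [this]
      exact smul_mem _ _ hx
  have horth : ∀ w ∈ span ℂ (v '' Iio i), inner ℂ e w = 0 := by
    intro w hw
    rw [← span_gramSchmidt_Iio ℂ v i] at hw
    induction hw using span_induction with
    | mem x hx =>
      obtain ⟨j, hj, rfl⟩ := hx
      rw [he, gramSchmidtNormed, inner_smul_left,
        gramSchmidt_orthogonal ℂ v (mem_Iio.1 hj).ne', mul_zero]
    | zero => simp
    | add x y _ _ hx hy => rw [inner_add_right, hx, hy, add_zero]
    | smul a x _ hx => rw [inner_smul_right, hx, mul_zero]
  have h := horth _ (hlow e hmem)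
  rw [inner_sub_right, inner_smul_right, inner_self_eq_norm_sq_to_K, hnorm] at h
  simpa [sub_eq_zero] using h

lemma exists_unitary_conj_apply_diag {X G : Matrix n n ℂ} (hG : IsUnit G.det) {d : n → ℂ}
    (h : X * G = G * diagonal d) :
    ∃ V : Matrix n n ℂ, star V * V = 1 ∧ ∀ i, (star V * X * V) i i = d i := by
  -- Gram–Schmidt needs an order on the columns of G, and `n` carries none.
  let σ := Fintype.equivFin n
  let v : Fin (Fintype.card n) → EuclideanSpace ℂ n := fun k => WithLp.toLp 2 (G.col (σ.symm k))
  have hv : LinearIndependent ℂ v := by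
    have h1 : LinearIndependent ℂ G.col :=
      Matrix.linearIndependent_cols_iff_isUnit.2 ((isUnit_iff_isUnit_det G).2 hG)
    have h2 := h1.comp σ.symm σ.symm.injective
    exact h2.map' (WithLp.linearEquiv 2 ℂ (n → ℂ)).symm.toLinearMap (LinearEquiv.ker _)
  have hT : ∀ k, Matrix.toEuclideanLin X (v k) = d (σ.symm k) • v k := by
    intro k
    ext i
    have := congrFun (congrFun h i) (σ.symm k)
    rw [mul_diagonal, Matrix.mul_apply] at this
    simp only [v, toLpLin_apply, PiLp.smul_apply, mulVec, dotProduct, col_apply, smul_eq_mul]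
    rw [this, mul_comm]
  set e := InnerProductSpace.gramSchmidtNormed ℂ v with he
  have hon : Orthonormal ℂ e := InnerProductSpace.gramSchmidtNormed_orthonormal hv
  refine ⟨Matrix.of fun i j => e (σ j) i, ?_, fun i => ?_⟩
  · ext i j
    have := (orthonormal_iff_ite.1 hon) (σ i) (σ j)
    rw [PiLp.inner_apply] at this
    rw [Matrix.mul_apply, one_apply]
    simpa [mul_comm] using this
  · have := inner_gramSchmidtNormed_eigenvector (Matrix.toEuclideanLin X) hv hT (σ i)
    rw [← he, PiLp.inner_apply, Equiv.symm_apply_apply] at this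
    rw [← this, Matrix.mul_assoc, Matrix.mul_apply]
    refine Finset.sum_congr rfl fun k _ => ?_
    simp [Matrix.mul_apply, toLpLin_apply, mulVec, dotProduct, mul_comm]

omit [DecidableEq n] in
lemma norm_conj_mul_apply_diag_sq_le (A B V : Matrix n n ℂ) (i : n) :
    ‖(star V * (Aᴴ * B) * V) i i‖ ^ 2 ≤
      ((star V * (Aᴴ * A) * V) i i).re * ((star V * (Bᴴ * B) * V) i i).re := by
  have h : ∀ C D : Matrix n n ℂ, (star V * (Cᴴ * D) * V) i i =
      ∑ k, star ((C * V) k i) * (D * V) k i := fun C D => by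
    have : star V * (Cᴴ * D) * V = (C * V)ᴴ * (D * V) := by
      rw [conjTranspose_mul]
      simp only [Matrix.mul_assoc, star_eq_conjTranspose]
    rw [this, Matrix.mul_apply]
    rfl
  have h' : ∀ C : Matrix n n ℂ, ((star V * (Cᴴ * C) * V) i i).re =
      ∑ k, ‖(C * V) k i‖ ^ 2 := fun C => by
    rw [h, Complex.re_sum]
    refine Finset.sum_congr rfl fun k _ => ?_
    rw [Complex.star_def, Complex.conj_mul']
    norm_cast
  rw [h', h', h]
  calc _ ≤ (∑ k, ‖(A * V) k i‖ * ‖(B * V) k i‖) ^ 2 := by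
        gcongr
        refine (norm_sum_le _ _).trans_eq (Finset.sum_congr rfl fun k _ => ?_)
        rw [norm_mul, norm_star]
    _ ≤ _ := Finset.sum_mul_sq_le_sq_mul_sq _ _ _

lemma sq_reTr_matPow_le_of_similar {z : ℝ} (hz : 1 ≤ z) {H A B G : Matrix n n ℂ}
    (hH : H.PosSemidef) (hG : IsUnit G.det) (h : Aᴴ * B * G = G * H) :
    reTr (matPow H z) ^ 2 ≤ reTr (matPow (Aᴴ * A) z) * reTr (matPow (Bᴴ * B) z) := by
  have hA := posSemidef_conjTranspose_mul_self A
  have hB := posSemidef_conjTranspose_mul_self B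
  have hz0 : 0 < z := by linarith
  set U := (hH.1.eigenvectorUnitary : Matrix n n ℂ) with hU
  have hUU : star U * U = 1 := Unitary.coe_star_mul_self _
  have hHU : H * U = U * diagonal (fun i => ((hH.1.eigenvalues i : ℝ) : ℂ)) := by
    have h0 : cfc (fun x : ℝ => x) H = H := cfc_id' ℝ H hH.1
    have h1 := cfc_eq_conj hH.1 (fun x => x)
    rw [h0] at h1
    conv_lhs => rw [h1]
    rw [Matrix.mul_assoc, hUU, Matrix.mul_one]
  have hGU : IsUnit (G * U).det := by
    rw [det_mul]
    refine hG.mul ?_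
    exact IsUnit.of_mul_eq_one_right (star U).det (by rw [← det_mul, hUU, det_one])
  -- The columns of `G * U` are eigenvectors of AᴴB for the eigenvalues of H.
  obtain ⟨V, hV, hd⟩ := exists_unitary_conj_apply_diag (X := Aᴴ * B) hGU
    (d := fun i => ((hH.1.eigenvalues i : ℝ) : ℂ))
    (by rw [← Matrix.mul_assoc, h, Matrix.mul_assoc, hHU, Matrix.mul_assoc])
  set a : n → ℝ := fun i => ((star V * (Aᴴ * A) * V) i i).re with ha
  set b : n → ℝ := fun i => ((star V * (Bᴴ * B) * V) i i).re with hb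
  have hnn : ∀ {K : Matrix n n ℂ}, K.PosSemidef → ∀ i, 0 ≤ ((star V * K * V) i i).re :=
    fun hK i => (Complex.le_def.1 (hK.conjTranspose_mul_mul_same V).diag_nonneg).1
  have ha0 : ∀ i, 0 ≤ a i := hnn hA
  have hb0 : ∀ i, 0 ≤ b i := hnn hB
  have hle : ∀ i, hH.1.eigenvalues i ^ z ≤ a i ^ (z / 2) * b i ^ (z / 2) := fun i => by
    have h1 := norm_conj_mul_apply_diag_sq_le A B V i
    rw [hd, Complex.norm_real, Real.norm_of_nonneg (hH.eigenvalues_nonneg i)] at h1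
    have h2 := Real.rpow_le_rpow (sq_nonneg _) h1 (show 0 ≤ z / 2 by linarith)
    rw [← Real.rpow_natCast, ← Real.rpow_mul (hH.eigenvalues_nonneg i),
      Real.mul_rpow (ha0 i) (hb0 i)] at h2
    convert h2 using 2
    push_cast
    ring
  have hsq : ∀ x : ℝ, 0 ≤ x → (x ^ (z / 2)) ^ 2 = x ^ z := fun x hx => by
    rw [← Real.rpow_natCast, ← Real.rpow_mul hx]
    congr 1
    push_cast
    ring
  calc reTr (matPow H z) ^ 2 = (∑ i, hH.1.eigenvalues i ^ z) ^ 2 := by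
        rw [reTr_matPow hH.1 hz0]
    _ ≤ (∑ i, a i ^ (z / 2) * b i ^ (z / 2)) ^ 2 :=
        pow_le_pow_left₀ (Finset.sum_nonneg fun i _ => Real.rpow_nonneg (hH.eigenvalues_nonneg i) _)
          (Finset.sum_le_sum fun i _ => hle i) 2
    _ ≤ (∑ i, (a i ^ (z / 2)) ^ 2) * ∑ i, (b i ^ (z / 2)) ^ 2 :=
        Finset.sum_mul_sq_le_sq_mul_sq _ _ _
    _ = (∑ i, a i ^ z) * ∑ i, b i ^ z := by
        congr 1
        · exact Finset.sum_congr rfl fun i _ => hsq _ (ha0 i)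
        · exact Finset.sum_congr rfl fun i _ => hsq _ (hb0 i)
    _ ≤ _ := mul_le_mul (peierls_of_one_le hA hV hz) (peierls_of_one_le hB hV hz)
        (Finset.sum_nonneg fun i _ => Real.rpow_nonneg (hb0 i) _) (reTr_matPow_nonneg hA hz0)

/-- If `H` is positive semidefinite and similar to `Aᴴ * B`, then
`(Tr H ^ z)² ≤ Tr (Aᴴ * A) ^ z * Tr (Bᴴ * B) ^ z` for every `z > 0`. -/
lemma sq_reTr_matPow_le {z : ℝ} (hz : 0 < z) {H A B G : Matrix n n ℂ}
    (hH : H.PosSemidef) (hG : IsUnit G.det) (h : Aᴴ * B * G = G * H) :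
    reTr (matPow H z) ^ 2 ≤ reTr (matPow (Aᴴ * A) z) * reTr (matPow (Bᴴ * B) z) := by
  rcases le_or_gt 1 z with hz1 | hz1
  · exact sq_reTr_matPow_le_of_similar hz1 hH hG h
  refine sq_reTr_matPow_le_of_det_eq hz hz1 hH fun x _ => ?_
  have h1 : (1 + (x : ℂ) • (Aᴴ * B)) * G = G * (1 + (x : ℂ) • H) := by
    rw [Matrix.add_mul, Matrix.mul_add, Matrix.smul_mul, h, Matrix.mul_smul, Matrix.one_mul,
      Matrix.mul_one]
  have h2 := congrArg det h1
  rw [det_mul, det_mul, mul_comm G.det] at h2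
  exact (hG.mul_right_cancel h2).symm

end

section

open Matrix Set

/-! ### Log-convexity -/

/-- Subtract the chord. If the difference g had a positive maximum on [0, 1], its leftmost maximiser
w would be interior; being the midpoint of w - δ and w + δ, it would force a maximiser further left.
-/
lemma convexOn_of_midpoint {φ : ℝ → ℝ} (hc : Continuous φ)
    (h : ∀ a b, φ ((a + b) / 2) ≤ (φ a + φ b) / 2) : ConvexOn ℝ univ φ := by
  refine ⟨convex_univ, fun a _ b _ s t hs ht hst => ?_⟩
  set g : ℝ → ℝ := fun u => φ (a + u * (b - a)) - (φ a + u * (φ b - φ a)) with hg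
  have hgc : Continuous g := by fun_prop
  have hgm : ∀ u w, g ((u + w) / 2) ≤ (g u + g w) / 2 := fun u w => by
    have := h (a + u * (b - a)) (a + w * (b - a))
    have e : (a + u * (b - a) + (a + w * (b - a))) / 2 = a + (u + w) / 2 * (b - a) := by ring
    rw [e] at this
    simp only [hg]
    linarith
  have hg0 : g 0 = 0 := by simp [hg]
  have hg1 : g 1 = 0 := by simp [hg]
  obtain ⟨u, hu, hmax⟩ := isCompact_Icc.exists_isMaxOn (nonempty_Icc.2 (zero_le_one' ℝ))
    hgc.continuousOn
  have hle : g u ≤ 0 := by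
    by_contra! hpos
    obtain ⟨w, ⟨hw, hwu⟩, hleast⟩ := (isCompact_Icc.inter_right
      (isClosed_eq hgc (continuous_const (y := g u)))).exists_isLeast ⟨u, hu, rfl⟩
    have hwu : g w = g u := hwu
    have hw0 : 0 < w := lt_of_le_of_ne hw.1 (by rintro rfl; linarith)
    have hw1 : w < 1 := lt_of_le_of_ne hw.2 (by rintro rfl; linarith)
    set δ := min w (1 - w) with hδ
    have hδ0 : 0 < δ := lt_min hw0 (by linarith)
    have h1 : w - δ ∈ Icc (0 : ℝ) 1 := ⟨by linarith [min_le_left w (1 - w)], by linarith⟩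
    have h2 : w + δ ∈ Icc (0 : ℝ) 1 := ⟨by linarith, by linarith [min_le_right w (1 - w)]⟩
    have h3 := hgm (w - δ) (w + δ)
    rw [show (w - δ + (w + δ)) / 2 = w by ring] at h3
    have h4 : g (w - δ) ≤ g u := hmax h1
    have h5 : g (w + δ) ≤ g u := hmax h2
    have h6 := hleast ⟨h1, show g (w - δ) = g u by linarith⟩
    linarith
  have ht1 : t ∈ Icc (0 : ℝ) 1 := ⟨ht, by linarith⟩
  have hgt : g t ≤ g u := hmax ht1
  have hfin : g t ≤ 0 := hgt.trans hle
  obtain rfl : s = 1 - t := by linarith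
  simp only [hg] at hfin
  rw [smul_eq_mul, smul_eq_mul, smul_eq_mul, smul_eq_mul,
    show (1 - t) * a + t * b = a + t * (b - a) by ring]
  linarith

/-- The convention 0 ↦ 0 for every exponent matters here: zero eigenvalues contribute a constant, so
there is no jump at t = 0. -/
lemma continuous_matPow {A : Matrix n n ℂ} (hA : A.IsHermitian) :
    Continuous fun t : ℝ => matPow A t := by
  simp only [matPow, cfc_eq_conj hA]
  refine (continuous_const.matrix_mul ?_).matrix_mul continuous_const
  refine Continuous.matrix_diagonal (continuous_pi fun i => Complex.continuous_ofReal.comp ?_)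
  by_cases h : hA.eigenvalues i = 0
  · simp only [h, if_true]
    exact continuous_const
  · simp only [h, if_false]
    exact Real.continuous_const_rpow h

open scoped Matrix.Norms.L2Operator in
lemma continuous_cfc_comp {f : ℝ → ℝ} (hf : Continuous f) {X : Type*} [TopologicalSpace X]
    {a : X → Matrix n n ℂ} (ha : Continuous a) (h : ∀ x, (a x).IsHermitian) :
    Continuous fun x => cfc f (a x) :=
  Continuous.cfc_of_mem_nhdsSet (s := univ) f Filter.univ_mem ha (fun x => h x) hf.continuousOn

/-- The positive semidefinite matrix whose `z`-th power has trace `Q α z ρ σ`. -/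
def sandwich (α z : ℝ) (ρ σ : Matrix n n ℂ) : Matrix n n ℂ :=
  matPow ρ (α / (2 * z)) * matPow σ ((1 - α) / z) * matPow ρ (α / (2 * z))

/-- The real-valued trace functional underlying `Q`. -/
def sandwichTr (α z : ℝ) (ρ σ : Matrix n n ℂ) : ℝ := reTr (matPow (sandwich α z ρ σ) z)

/-- A square root of `sandwich`. -/
def sandwichRoot (α z : ℝ) (ρ σ : Matrix n n ℂ) : Matrix n n ℂ :=
  matPow σ ((1 - α) / (2 * z)) * matPow ρ (α / (2 * z))

variable {ρ σ : Matrix n n ℂ}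

lemma sandwichRoot_conjTranspose_mul (hσ : σ.PosSemidef) (a b z : ℝ) :
    (sandwichRoot a z ρ σ)ᴴ * sandwichRoot b z ρ σ =
      matPow ρ (a / (2 * z)) * matPow σ ((1 - (a + b) / 2) / z) * matPow ρ (b / (2 * z)) := by
  rw [sandwichRoot, sandwichRoot, conjTranspose_mul, (isHermitian_matPow _ _).eq,
    (isHermitian_matPow _ _).eq, Matrix.mul_assoc, ← Matrix.mul_assoc (matPow σ _),
    matPow_mul_matPow hσ, Matrix.mul_assoc]
  congr 3
  ring

lemma sandwich_eq (hσ : σ.PosSemidef) (α z : ℝ) :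
    sandwich α z ρ σ = (sandwichRoot α z ρ σ)ᴴ * sandwichRoot α z ρ σ := by
  rw [sandwichRoot_conjTranspose_mul hσ, sandwich, add_self_div_two]

lemma posSemidef_sandwich (hσ : σ.PosSemidef) (α z : ℝ) : (sandwich α z ρ σ).PosSemidef := by
  rw [sandwich_eq hσ]
  exact posSemidef_conjTranspose_mul_self _

lemma sandwichTr_nonneg (hσ : σ.PosSemidef) (α : ℝ) {z : ℝ} (hz : 0 < z) :
    0 ≤ sandwichTr α z ρ σ :=
  reTr_matPow_nonneg (posSemidef_sandwich hσ α z) hz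

lemma sandwichTr_midpoint (hρ : ρ.PosSemidef) (hσ : σ.PosSemidef) {z : ℝ} (hz : 0 < z)
    (a b : ℝ) :
    sandwichTr ((a + b) / 2) z ρ σ ^ 2 ≤ sandwichTr a z ρ σ * sandwichTr b z ρ σ := by
  set m := (a + b) / 2 with hm
  set s := (a - m) / (2 * z) with hs
  -- The value 1 on the kernel makes G invertible, unlike `matPow ρ s`. As s = (a - m) / 2z = (m -
  -- b) / 2z, one G shifts both outer exponents to the required values.
  set G := cfc (fun x : ℝ => if x = 0 then 1 else x ^ s) ρ with hG
  have hGu : IsUnit G.det := by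
    have h1 : G * cfc (fun x : ℝ => if x = 0 then 1 else x ^ (-s)) ρ = 1 := by
      rw [hG, cfc_mul_cfc, cfc_congr_of_posSemidef hρ (g := fun _ => 1) fun x hx => ?_]
      · exact cfc_const_one ℝ ρ hρ.1
      · by_cases h : x = 0
        · simp [h]
        · simp [h, ← Real.rpow_add (lt_of_le_of_ne hx (Ne.symm h))]
    exact IsUnit.of_mul_eq_one _ (by rw [← det_mul, h1, det_one])
  have hGl : ∀ t, G * matPow ρ t = matPow ρ (s + t) := fun t => by
    rw [hG, matPow, matPow, cfc_mul_cfc]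
    refine cfc_congr_of_posSemidef hρ fun x hx => ?_
    by_cases h : x = 0
    · simp [h]
    · simp [h, Real.rpow_add (lt_of_le_of_ne hx (Ne.symm h))]
  have hGr : ∀ t, matPow ρ t * G = matPow ρ (t + s) := fun t => by
    rw [hG, matPow, matPow, cfc_mul_cfc]
    refine cfc_congr_of_posSemidef hρ fun x hx => ?_
    by_cases h : x = 0
    · simp [h]
    · simp [h, Real.rpow_add (lt_of_le_of_ne hx (Ne.symm h))]
  have key : (sandwichRoot a z ρ σ)ᴴ * sandwichRoot b z ρ σ * G = G * sandwich m z ρ σ := by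
    rw [sandwichRoot_conjTranspose_mul hσ, sandwich, Matrix.mul_assoc, hGr, ← Matrix.mul_assoc,
      ← Matrix.mul_assoc, hGl]
    congr 3
    · rw [hs]
      ring
    · rw [hs, hm]
      ring
  have := sq_reTr_matPow_le hz (posSemidef_sandwich (ρ := ρ) hσ m z) hGu key
  rwa [← sandwich_eq hσ, ← sandwich_eq hσ] at this

lemma continuous_sandwichTr (hρ : ρ.PosSemidef) (hσ : σ.PosSemidef) {z : ℝ} (hz : 0 < z) :
    Continuous fun α => sandwichTr α z ρ σ := by
  have h1 : Continuous fun α => sandwich α z ρ σ := by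
    have hr : Continuous fun α : ℝ => matPow ρ (α / (2 * z)) :=
      (continuous_matPow hρ.1).comp (continuous_id.div_const _)
    have hs : Continuous fun α : ℝ => matPow σ ((1 - α) / z) :=
      (continuous_matPow hσ.1).comp ((continuous_const.sub continuous_id).div_const _)
    exact (hr.matrix_mul hs).matrix_mul hr
  have h2 := continuous_cfc_comp (Real.continuous_rpow_const hz.le) h1
    fun α => (posSemidef_sandwich hσ α z).1
  simp only [sandwichTr, reTr, matPow_of_pos _ hz]
  exact Complex.continuous_re.comp h2.matrix_trace

/-- A vanishing trace forces `sandwichRoot` to vanish; multiplying by the inverse powers on both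
sides leaves the product of supports. -/
lemma supp_mul_supp_eq_zero (hρ : ρ.PosSemidef) (hσ : σ.PosSemidef) {α z : ℝ} (hz : 0 < z)
    (h : sandwichTr α z ρ σ = 0) : supp ρ * supp σ = 0 := by
  have h1 := reTr_matPow_eq_zero (posSemidef_sandwich hσ α z) hz h
  rw [sandwich_eq hσ, conjTranspose_mul_self_eq_zero] at h1
  have h2 : supp σ * supp ρ = 0 := by
    have : matPow σ (-((1 - α) / (2 * z))) * sandwichRoot α z ρ σ * matPow ρ (-(α / (2 * z))) =
        supp σ * supp ρ := by
      rw [sandwichRoot, ← Matrix.mul_assoc, matPow_mul_matPow hσ, Matrix.mul_assoc,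
        matPow_mul_matPow hρ, neg_add_cancel, add_neg_cancel, supp, supp]
    rw [← this, h1, Matrix.mul_zero, Matrix.zero_mul]
  have h3 := congrArg conjTranspose h2
  rwa [conjTranspose_mul, supp, supp, (isHermitian_matPow _ _).eq, (isHermitian_matPow _ _).eq,
    conjTranspose_zero] at h3

lemma sandwichTr_pos (hρ : ρ.PosSemidef) (hσ : σ.PosSemidef) (h : supp ρ * supp σ ≠ 0) (α : ℝ)
    {z : ℝ} (hz : 0 < z) : 0 < sandwichTr α z ρ σ :=
  lt_of_le_of_ne (sandwichTr_nonneg hσ α hz) fun h0 => h (supp_mul_supp_eq_zero hρ hσ hz h0.symm)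

lemma convexOn_log_sandwichTr (hρ : ρ.PosSemidef) (hσ : σ.PosSemidef)
    (h : supp ρ * supp σ ≠ 0) {z : ℝ} (hz : 0 < z) :
    ConvexOn ℝ univ fun α => Real.log (sandwichTr α z ρ σ) := by
  have hpos := fun α => sandwichTr_pos hρ hσ h α hz
  refine convexOn_of_midpoint
    ((continuous_sandwichTr hρ hσ hz).log fun α => (hpos α).ne') fun a b => ?_
  have := Real.log_le_log (pow_pos (hpos _) 2) (sandwichTr_midpoint hρ hσ hz a b)
  rw [Real.log_pow, Real.log_mul (hpos a).ne' (hpos b).ne'] at this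
  push_cast at this
  linarith

/-- Log-convexity of `α ↦ Tr (ρ ^ (α / 2z) σ ^ ((1 - α) / z) ρ ^ (α / 2z)) ^ z` on the real line. -/
lemma sandwichTr_le_rpow_mul_rpow (hρ : ρ.PosSemidef) (hσ : σ.PosSemidef)
    (h : supp ρ * supp σ ≠ 0) {z : ℝ} (hz : 0 < z) (a b : ℝ) {θ : ℝ} (h0 : 0 ≤ θ) (h1 : θ ≤ 1) :
    sandwichTr (θ * a + (1 - θ) * b) z ρ σ ≤
      sandwichTr a z ρ σ ^ θ * sandwichTr b z ρ σ ^ (1 - θ) := by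
  have hpos := fun α => sandwichTr_pos hρ hσ h α hz
  have := (convexOn_log_sandwichTr hρ hσ h hz).2 (mem_univ a) (mem_univ b) h0
    (sub_nonneg.2 h1) (add_sub_cancel _ _)
  simp only [smul_eq_mul] at this
  rw [← Real.log_le_log_iff (hpos _) (by have := hpos a; have := hpos b; positivity),
    Real.log_mul (Real.rpow_pos_of_pos (hpos a) _).ne' (Real.rpow_pos_of_pos (hpos b) _).ne',
    Real.log_rpow (hpos a), Real.log_rpow (hpos b)]
  exact this

end

section

open Matrix Set Filter Topology

/-! ### The tangent at `α = 1` -/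

/-- A convex function which touches a differentiable function at `x` from one side lies above the
tangent of the latter at `x`. -/
lemma tangent_le_of_touching {f q : ℝ → ℝ} {c x : ℝ} (hf : ConvexOn ℝ univ f)
    (hq : HasDerivAt q c x) (hx : q x = f x)
    (h : (∀ᶠ y in 𝓝 x, q y ≤ f y) ∨ ∀ᶠ y in 𝓝 x, f y ≤ q y) (y : ℝ) :
    f x + c * (y - x) ≤ f y := by
  set p : ℝ → ℝ := fun t => q (x + t * (y - x)) with hp
  have hp0 : p 0 = f x := by simp [hp, hx]
  have hlin : HasDerivAt (fun t : ℝ => x + t * (y - x)) (y - x) 0 := by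
    simpa using ((hasDerivAt_id (0 : ℝ)).mul_const (y - x)).const_add x
  have hpd : HasDerivAt p (c * (y - x)) 0 := by
    refine HasDerivAt.comp (h₂ := q) 0 ?_ hlin
    simpa using hq
  have hslope := hasDerivAt_iff_tendsto_slope.1 hpd
  have hlim : Tendsto (fun t : ℝ => x + t * (y - x)) (𝓝 0) (𝓝 x) := by
    have := hlin.continuousAt.tendsto
    simpa using this
  suffices c * (y - x) ≤ f y - f x by linarith
  -- If q ≤ f near x, slopes are taken at t > 0, towards y. If f ≤ q, they are taken at t < 0, where
  -- dividing by t reverses the inequality; x then lies between x + t(y - x) and y.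
  rcases h with h | h
  · refine le_of_tendsto (hslope.mono_left (nhdsWithin_mono 0
      (show Ioi (0 : ℝ) ⊆ {0}ᶜ from fun t ht => (mem_Ioi.1 ht).ne'))) ?_
    filter_upwards [self_mem_nhdsWithin, nhdsWithin_le_nhds (hlim.eventually h),
      nhdsWithin_le_nhds (Iio_mem_nhds one_pos)] with t ht hle ht1
    have ht : 0 < t := ht
    have ht1 : t < 1 := ht1
    rw [slope_def_field, sub_zero, div_le_iff₀ ht, hp0]
    have hc := hf.2 (mem_univ x) (mem_univ y) (sub_nonneg.2 ht1.le) ht.le (sub_add_cancel _ _)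
    rw [smul_eq_mul, smul_eq_mul, smul_eq_mul, smul_eq_mul,
      show (1 - t) * x + t * y = x + t * (y - x) by ring] at hc
    simp only [hp]
    linarith
  · refine le_of_tendsto (hslope.mono_left (nhdsWithin_mono 0
      (show Iio (0 : ℝ) ⊆ {0}ᶜ from fun t ht => (mem_Iio.1 ht).ne))) ?_
    filter_upwards [self_mem_nhdsWithin, nhdsWithin_le_nhds (hlim.eventually h)] with t ht hle
    have ht : t < 0 := ht
    rw [slope_def_field, sub_zero, div_le_iff_of_neg ht, hp0]
    have h1 : 0 < 1 - t := by linarith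
    have hc := hf.2 (mem_univ (x + t * (y - x))) (mem_univ y) (one_div_pos.2 h1).le
      (div_nonneg (neg_nonneg.2 ht.le) h1.le) (by field_simp; ring)
    rw [smul_eq_mul, smul_eq_mul, smul_eq_mul, smul_eq_mul,
      show 1 / (1 - t) * (x + t * (y - x)) + -t / (1 - t) * y = x by field_simp; ring,
      show 1 / (1 - t) * f (x + t * (y - x)) + -t / (1 - t) * f y =
        (f (x + t * (y - x)) - t * f y) / (1 - t) by ring, le_div_iff₀ h1] at hc
    simp only [hp]
    linarith

lemma conj_eigenvectorUnitary_cfc_apply_diag {A : Matrix n n ℂ} (hA : A.IsHermitian) (f : ℝ → ℝ)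
    (i : n) :
    (star (hA.eigenvectorUnitary : Matrix n n ℂ) * cfc f A *
      (hA.eigenvectorUnitary : Matrix n n ℂ)) i i = ((f (hA.eigenvalues i) : ℝ) : ℂ) := by
  rw [conj_cfc_apply_diag hA]
  simp [weight, Matrix.one_apply, apply_ite Complex.normSq]

lemma reTr_mul {A : Matrix n n ℂ} (hA : A.IsHermitian) (X : Matrix n n ℂ) :
    reTr (A * X) = ∑ i, hA.eigenvalues i * ((star (hA.eigenvectorUnitary : Matrix n n ℂ) * X *
      (hA.eigenvectorUnitary : Matrix n n ℂ)) i i).re := by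
  have h0 : cfc (fun x : ℝ => x) A = A := cfc_id' ℝ A hA
  have h1 := cfc_eq_conj hA (fun x => x)
  rw [h0] at h1
  conv_lhs => rw [h1]
  rw [reTr, Matrix.mul_assoc (_ * _), Matrix.mul_assoc (hA.eigenvectorUnitary : Matrix n n ℂ),
    trace_mul_comm (hA.eigenvectorUnitary : Matrix n n ℂ), Matrix.mul_assoc (diagonal _),
    trace, Complex.re_sum]
  refine Finset.sum_congr rfl fun i _ => ?_
  rw [diag_apply, diagonal_mul, Complex.re_ofReal_mul]

/-! ### Support projections and the value at α = 1. -/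

lemma isIdempotent_supp {A : Matrix n n ℂ} (hA : A.PosSemidef) : supp A * supp A = supp A := by
  rw [supp, matPow_mul_matPow hA, add_zero]

lemma posSemidef_one_sub_supp {A : Matrix n n ℂ} (hA : A.PosSemidef) :
    (1 - supp A).PosSemidef := by
  have h1 : (1 - supp A)ᴴ = 1 - supp A := by
    rw [conjTranspose_sub, conjTranspose_one, supp, (isHermitian_matPow _ _).eq]
  have h2 : (1 - supp A) * (1 - supp A) = 1 - supp A := by
    rw [Matrix.mul_sub, Matrix.sub_mul, Matrix.sub_mul, isIdempotent_supp hA]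
    simp
  have := posSemidef_conjTranspose_mul_self (1 - supp A)
  rwa [h1, h2] at this

/-- Compressing A⁰ ≤ B⁰ by 1 - B⁰ gives (1 - B⁰) A⁰ (1 - B⁰) ≤ 0. This is also a Gram matrix, so A⁰
(1 - B⁰) = 0. -/
lemma supp_mul_supp_of_le {A B : Matrix n n ℂ} (hA : A.PosSemidef) (hB : B.PosSemidef)
    (h : supp A ≤ supp B) : supp A * supp B = supp A := by
  have hA' : (supp A)ᴴ = supp A := isHermitian_matPow _ _
  have hB' : (1 - supp B)ᴴ = 1 - supp B := (posSemidef_one_sub_supp hB).1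
  set Y := (supp A * (1 - supp B))ᴴ * (supp A * (1 - supp B)) with hY
  have h1 : Y = (1 - supp B) * supp A * (1 - supp B) := by
    rw [hY, conjTranspose_mul, hA', hB', Matrix.mul_assoc, ← Matrix.mul_assoc (supp A),
      isIdempotent_supp hA, Matrix.mul_assoc]
  have h2 : (-Y).PosSemidef := by
    have := (le_iff.1 h).conjTranspose_mul_mul_same (1 - supp B)
    have e : (1 - supp B) * supp B = 0 := by
      rw [Matrix.sub_mul, Matrix.one_mul, isIdempotent_supp hB, sub_self]
    rwa [hB', Matrix.mul_sub (1 - supp B), e, zero_sub, Matrix.neg_mul, ← h1] at this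
  have h3 : Y = 0 := le_antisymm (by simpa using nonneg_iff_posSemidef.2 h2)
    (nonneg_iff_posSemidef.2 (posSemidef_conjTranspose_mul_self _))
  have h4 := conjTranspose_mul_self_eq_zero.1 h3
  rw [Matrix.mul_sub, Matrix.mul_one, sub_eq_zero] at h4
  exact h4.symm

lemma supp_eq_zero {A : Matrix n n ℂ} (hA : A.PosSemidef) (h : supp A = 0) : A = 0 := by
  rw [← matPow_one hA, ← add_zero (1 : ℝ), ← matPow_mul_matPow hA, ← supp, h, Matrix.mul_zero]

lemma reTr_pos {A : Matrix n n ℂ} (hA : A.PosSemidef) (h : A ≠ 0) : 0 < reTr A := by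
  have h1 := reTr_matPow_nonneg hA one_pos
  rw [matPow_one hA] at h1
  refine lt_of_le_of_ne h1 fun h0 => h (reTr_matPow_eq_zero hA one_pos ?_)
  rw [matPow_one hA, ← h0]

variable {ρ σ : Matrix n n ℂ}

lemma matPow_inv_matPow (hρ : ρ.PosSemidef) {z : ℝ} (hz : 0 < z) :
    matPow (matPow ρ (1 / z)) z = ρ := by
  have h : cfc (fun x : ℝ => (x ^ (1 / z)) ^ z) ρ = cfc (fun x : ℝ => x ^ z)
      (cfc (fun x : ℝ => x ^ (1 / z)) ρ) :=
    cfc_comp' (fun x : ℝ => x ^ z) (fun x : ℝ => x ^ (1 / z)) ρ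
      ((ρ.finite_real_spectrum.image _).continuousOn _) (continuousOn_spectrum ρ _) hρ.1
  have h0 : cfc (fun x : ℝ => x) ρ = ρ := cfc_id' ℝ ρ hρ.1
  rw [matPow_of_pos _ hz, matPow_of_pos _ (by positivity), ← h]
  conv_rhs => rw [← h0]
  refine cfc_congr_of_posSemidef hρ fun x hx => ?_
  rw [← Real.rpow_mul hx, one_div_mul_cancel hz.ne', Real.rpow_one]

lemma matPow_half_mul_half (hρ : ρ.PosSemidef) (z : ℝ) :
    matPow ρ (1 / (2 * z)) * matPow ρ (1 / (2 * z)) = matPow ρ (1 / z) := by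
  rw [matPow_mul_matPow hρ]
  congr 1
  ring

lemma sandwich_one (z : ℝ) (ρ σ : Matrix n n ℂ) :
    sandwich 1 z ρ σ = matPow ρ (1 / (2 * z)) * supp σ * matPow ρ (1 / (2 * z)) := by
  rw [sandwich, sub_self, zero_div, supp]

lemma sandwichTr_one_le (hρ : ρ.PosSemidef) (hσ : σ.PosSemidef) {z : ℝ} (hz : 0 < z) :
    sandwichTr 1 z ρ σ ≤ reTr ρ := by
  have h : sandwich 1 z ρ σ ≤ matPow ρ (1 / z) := by
    have := (posSemidef_one_sub_supp hσ).conjTranspose_mul_mul_same (matPow ρ (1 / (2 * z)))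
    rw [(isHermitian_matPow _ _).eq, Matrix.mul_sub, Matrix.sub_mul, Matrix.mul_one,
      matPow_half_mul_half hρ, ← sandwich_one] at this
    exact le_iff.2 this
  have := reTr_matPow_mono (posSemidef_sandwich hσ 1 z) (posSemidef_matPow hρ _) h hz
  rwa [matPow_inv_matPow hρ hz] at this

lemma sandwichTr_one (hρ : ρ.PosSemidef) (hσ : σ.PosSemidef) (h : supp ρ ≤ supp σ) {z : ℝ}
    (hz : 0 < z) : sandwichTr 1 z ρ σ = reTr ρ := by
  have h1 : matPow ρ (1 / (2 * z)) * supp σ = matPow ρ (1 / (2 * z)) := by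
    have h2 : matPow ρ (1 / (2 * z)) = matPow ρ (1 / (2 * z)) * supp ρ := by
      rw [supp, matPow_mul_matPow hρ, add_zero]
    rw [h2, Matrix.mul_assoc, supp_mul_supp_of_le hρ hσ h]
  rw [sandwichTr, sandwich_one, h1, matPow_half_mul_half hρ, matPow_inv_matPow hρ hz]

/-- The overlap `‖⟨f_j, e_i⟩‖²` of the eigenvectors `e_i` of `ρ` and `f_j` of `σ`. -/
def overlap (hρ : ρ.PosSemidef) (hσ : σ.PosSemidef) (i j : n) : ℝ :=
  weight hσ.1 (hρ.1.eigenvectorUnitary : Matrix n n ℂ) i j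

/-- The diagonal entry of `σ ^ t` in the eigenbasis of `ρ`. -/
def diagPow (hρ : ρ.PosSemidef) (hσ : σ.PosSemidef) (t : ℝ) (i : n) : ℝ :=
  ∑ j, overlap hρ hσ i j *
    (if hσ.1.eigenvalues j = 0 then 0 else hσ.1.eigenvalues j ^ t)

lemma diagPow_nonneg (hρ : ρ.PosSemidef) (hσ : σ.PosSemidef) (t : ℝ) (i : n) :
    0 ≤ diagPow hρ hσ t i := by
  refine Finset.sum_nonneg fun j _ => mul_nonneg (weight_nonneg _ _ _ _) ?_
  split_ifs
  · exact le_rfl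
  · exact Real.rpow_nonneg (hσ.eigenvalues_nonneg j) _

lemma conj_matPow_apply_diag (hρ : ρ.PosSemidef) (hσ : σ.PosSemidef) (t : ℝ) (i : n) :
    (star (hρ.1.eigenvectorUnitary : Matrix n n ℂ) * matPow σ t *
      (hρ.1.eigenvectorUnitary : Matrix n n ℂ)) i i = ((diagPow hρ hσ t i : ℝ) : ℂ) :=
  conj_cfc_apply_diag hσ.1 _ _ i

/-- An eigenvector of ρ with nonzero eigenvalue lies in the support of σ, so σ⁰ has expectation 1 in
it. -/
lemma diagPow_zero (hρ : ρ.PosSemidef) (hσ : σ.PosSemidef) (h : supp ρ ≤ supp σ) {i : n}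
    (hi : hρ.1.eigenvalues i ≠ 0) : diagPow hρ hσ 0 i = 1 := by
  refine le_antisymm ?_ ?_
  · rw [← sum_weight_right hσ.1 (Unitary.coe_star_mul_self hρ.1.eigenvectorUnitary) i]
    refine Finset.sum_le_sum fun j _ => ?_
    refine mul_le_of_le_one_right (weight_nonneg _ _ _ _) ?_
    split_ifs <;> simp
  · have h1 := ((le_iff.1 h).conjTranspose_mul_mul_same
      (hρ.1.eigenvectorUnitary : Matrix n n ℂ)).diag_nonneg (i := i)
    rw [Matrix.mul_sub, Matrix.sub_mul, Matrix.sub_apply, sub_nonneg] at h1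
    have h2 := conj_matPow_apply_diag hρ hσ 0 i
    have h3 := conj_eigenvectorUnitary_cfc_apply_diag hρ.1
      (fun x : ℝ => if x = 0 then 0 else x ^ (0 : ℝ)) i
    rw [star_eq_conjTranspose] at h2 h3
    rw [supp, supp, h2, matPow, h3, Complex.real_le_real] at h1
    simpa [hi] using h1

/-- The pinched functional: the sum of the `z`-th powers of the diagonal entries of
`sandwich α z ρ σ` in the eigenbasis of `ρ`. -/
def pinchedTr (hρ : ρ.PosSemidef) (hσ : σ.PosSemidef) (α z : ℝ) : ℝ :=
  ∑ i, hρ.1.eigenvalues i ^ α * diagPow hρ hσ ((1 - α) / z) i ^ z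

lemma conj_sandwich_apply_diag (hρ : ρ.PosSemidef) (hσ : σ.PosSemidef) (α z : ℝ) (i : n) :
    ((star (hρ.1.eigenvectorUnitary : Matrix n n ℂ) * sandwich α z ρ σ *
      (hρ.1.eigenvectorUnitary : Matrix n n ℂ)) i i).re =
      (if hρ.1.eigenvalues i = 0 then 0 else hρ.1.eigenvalues i ^ (α / z)) *
        diagPow hρ hσ ((1 - α) / z) i := by
  set R := (hρ.1.eigenvectorUnitary : Matrix n n ℂ) with hR
  have hRR : star R * R = 1 := Unitary.coe_star_mul_self _
  set d : n → ℂ := fun i => (((if hρ.1.eigenvalues i = 0 then 0 else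
    hρ.1.eigenvalues i ^ (α / (2 * z)) : ℝ)) : ℂ) with hd
  have hpow : matPow ρ (α / (2 * z)) = R * diagonal d * star R := cfc_eq_conj hρ.1 _
  have h : star R * sandwich α z ρ σ * R =
      diagonal d * (star R * matPow σ ((1 - α) / z) * R) * diagonal d := by
    rw [sandwich, hpow]
    have e : ∀ S : Matrix n n ℂ, star R * (R * diagonal d * star R * S * (R * diagonal d * star R))
        * R = (star R * R) * diagonal d * (star R * S * R) * diagonal d * (star R * R) := fun S => by
      simp only [Matrix.mul_assoc]
    rw [e, hRR, Matrix.one_mul, Matrix.mul_one]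
  rw [h, mul_diagonal, diagonal_mul, conj_matPow_apply_diag hρ hσ, hd, ← Complex.ofReal_mul,
    ← Complex.ofReal_mul, Complex.ofReal_re]
  split_ifs with h0
  · simp
  · have hpos := lt_of_le_of_ne (hρ.eigenvalues_nonneg i) (Ne.symm h0)
    have : hρ.1.eigenvalues i ^ (α / z) = hρ.1.eigenvalues i ^ (α / (2 * z)) *
        hρ.1.eigenvalues i ^ (α / (2 * z)) := by
      rw [← Real.rpow_add hpos]
      congr 1
      ring
    rw [this]
    ring

/-- The exponent α = 0 is excluded because a zero eigenvalue has real power 0 ^ 0 = 1, whereas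
`matPow` sends it to 0. -/
lemma conj_sandwich_apply_diag_rpow (hρ : ρ.PosSemidef) (hσ : σ.PosSemidef) {α z : ℝ}
    (hα : α ≠ 0) (hz : 0 < z) (i : n) :
    ((star (hρ.1.eigenvectorUnitary : Matrix n n ℂ) * sandwich α z ρ σ *
      (hρ.1.eigenvectorUnitary : Matrix n n ℂ)) i i).re ^ z =
      hρ.1.eigenvalues i ^ α * diagPow hρ hσ ((1 - α) / z) i ^ z := by
  rw [conj_sandwich_apply_diag hρ hσ]
  split_ifs with h0
  · rw [h0, zero_mul, Real.zero_rpow hz.ne', Real.zero_rpow hα, zero_mul]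
  · rw [Real.mul_rpow (Real.rpow_nonneg (hρ.eigenvalues_nonneg i) _) (diagPow_nonneg hρ hσ _ i),
      ← Real.rpow_mul (hρ.eigenvalues_nonneg i), div_mul_cancel₀ _ hz.ne']

lemma pinchedTr_le (hρ : ρ.PosSemidef) (hσ : σ.PosSemidef) {α z : ℝ} (hα : α ≠ 0) (hz : 1 ≤ z) :
    pinchedTr hρ hσ α z ≤ sandwichTr α z ρ σ := by
  have := peierls_of_one_le (posSemidef_sandwich (ρ := ρ) hσ α z)
    (Unitary.coe_star_mul_self hρ.1.eigenvectorUnitary) hz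
  simp only [conj_sandwich_apply_diag_rpow hρ hσ hα (show 0 < z by linarith)] at this
  exact this

lemma le_pinchedTr (hρ : ρ.PosSemidef) (hσ : σ.PosSemidef) {α z : ℝ} (hα : α ≠ 0) (hz : 0 < z)
    (hz1 : z ≤ 1) : sandwichTr α z ρ σ ≤ pinchedTr hρ hσ α z := by
  have := peierls_of_le_one (posSemidef_sandwich (ρ := ρ) hσ α z)
    (Unitary.coe_star_mul_self hρ.1.eigenvectorUnitary) hz hz1
  simp only [conj_sandwich_apply_diag_rpow hρ hσ hα hz] at this
  exact this

lemma pinchedTr_one (hρ : ρ.PosSemidef) (hσ : σ.PosSemidef) (h : supp ρ ≤ supp σ) (z : ℝ) :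
    pinchedTr hρ hσ 1 z = reTr ρ := by
  have h1 : reTr ρ = ∑ i, hρ.1.eigenvalues i := by
    conv_lhs => rw [← matPow_one hρ]
    rw [reTr_matPow hρ.1 one_pos]
    simp
  rw [h1]
  refine Finset.sum_congr rfl fun i _ => ?_
  by_cases h0 : hρ.1.eigenvalues i = 0
  · simp [h0]
  · rw [sub_self, zero_div, diagPow_zero hρ hσ h h0, Real.one_rpow, mul_one, Real.rpow_one]

lemma reTr_mul_log_sub_log (hρ : ρ.PosSemidef) (hσ : σ.PosSemidef) :
    reTr (ρ * (cfc Real.log ρ - cfc Real.log σ)) = ∑ i, hρ.1.eigenvalues i *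
      (Real.log (hρ.1.eigenvalues i) - ∑ j, overlap hρ hσ i j * Real.log (hσ.1.eigenvalues j)) := by
  rw [reTr_mul hρ.1]
  refine Finset.sum_congr rfl fun i _ => ?_
  rw [Matrix.mul_sub, Matrix.sub_mul, Matrix.sub_apply,
    conj_eigenvectorUnitary_cfc_apply_diag hρ.1, conj_cfc_apply_diag hσ.1, ← Complex.ofReal_sub,
    Complex.ofReal_re]
  rfl

lemma hasDerivAt_diagPow (hρ : ρ.PosSemidef) (hσ : σ.PosSemidef) (z : ℝ) (i : n) :
    HasDerivAt (fun α : ℝ => diagPow hρ hσ ((1 - α) / z) i)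
      (∑ j, overlap hρ hσ i j * (Real.log (hσ.1.eigenvalues j) * (-1 / z))) 1 := by
  refine HasDerivAt.fun_sum fun j _ => HasDerivAt.const_mul _ ?_
  by_cases h : hσ.1.eigenvalues j = 0
  · simp only [h, if_true, Real.log_zero, zero_mul]
    exact hasDerivAt_const _ _
  · simp only [h, if_false]
    have h1 : HasDerivAt (fun α : ℝ => (1 - α) / z) (-1 / z) 1 :=
      ((hasDerivAt_id (1 : ℝ)).const_sub 1).div_const z
    have h2 := h1.const_rpow (lt_of_le_of_ne (hσ.eigenvalues_nonneg j) (Ne.symm h))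
    simpa using h2

/-- The outer power contributes a factor z and the inner exponent (1 - α) / z a factor -1/z, so the
slope is independent of z. -/
lemma hasDerivAt_pinchedTr (hρ : ρ.PosSemidef) (hσ : σ.PosSemidef) (h : supp ρ ≤ supp σ) {z : ℝ}
    (hz : 0 < z) :
    HasDerivAt (fun α => pinchedTr hρ hσ α z)
      (reTr (ρ * (cfc Real.log ρ - cfc Real.log σ))) 1 := by
  rw [reTr_mul_log_sub_log hρ hσ]
  refine HasDerivAt.fun_sum fun i _ => ?_
  by_cases h0 : hρ.1.eigenvalues i = 0
  · rw [h0, zero_mul]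
    refine (hasDerivAt_const (1 : ℝ) (0 : ℝ)).congr_of_eventuallyEq ?_
    filter_upwards [isOpen_ne.mem_nhds (one_ne_zero : (1 : ℝ) ≠ 0)] with α hα
    rw [Real.zero_rpow hα, zero_mul]
  · have hpos := lt_of_le_of_ne (hρ.eigenvalues_nonneg i) (Ne.symm h0)
    have h1 : diagPow hρ hσ ((1 - 1) / z) i = 1 := by
      rw [sub_self, zero_div, diagPow_zero hρ hσ h h0]
    have h2 := (hasDerivAt_diagPow hρ hσ z i).rpow_const (p := z) (Or.inl (by rw [h1]; norm_num))
    have h3 := (hasDerivAt_id (1 : ℝ)).const_rpow hpos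
    have h4 := h3.fun_mul h2
    refine h4.congr_deriv ?_
    have h5 : ∑ j, overlap hρ hσ i j * (Real.log (hσ.1.eigenvalues j) * (-1 / z)) =
        (-1 / z) * ∑ j, overlap hρ hσ i j * Real.log (hσ.1.eigenvalues j) := by
      rw [Finset.mul_sum]
      exact Finset.sum_congr rfl fun j _ => by ring
    simp only [id_eq, h1, h5, Real.one_rpow, Real.rpow_one]
    field_simp
    ring

/-- The tangent inequality for `α ↦ log Q` at `α = 1`, whose slope is the normalised relative
entropy. -/
lemma log_sandwichTr_ge (hρ : ρ.PosSemidef) (hσ : σ.PosSemidef) (hρ0 : ρ ≠ 0)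
    (h : supp ρ ≤ supp σ) {z : ℝ} (hz : 0 < z) (α : ℝ) :
    Real.log (reTr ρ) + reTr (ρ * (cfc Real.log ρ - cfc Real.log σ)) / reTr ρ * (α - 1) ≤
      Real.log (sandwichTr α z ρ σ) := by
  have hne : supp ρ * supp σ ≠ 0 := by
    rw [supp_mul_supp_of_le hρ hσ h]
    exact fun h0 => hρ0 (supp_eq_zero hρ h0)
  have hT := reTr_pos hρ hρ0
  have hq1 := pinchedTr_one hρ hσ h z
  have hqd := hasDerivAt_pinchedTr hρ hσ h hz
  have hlog := hqd.log (by rw [hq1]; exact hT.ne')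
  have hev : ∀ᶠ y : ℝ in 𝓝 1, y ≠ 0 := isOpen_ne.mem_nhds (one_ne_zero : (1 : ℝ) ≠ 0)
  have key := tangent_le_of_touching (convexOn_log_sandwichTr hρ hσ hne hz) hlog
    (by rw [hq1, sandwichTr_one hρ hσ h hz]) ?_ α
  · rwa [sandwichTr_one hρ hσ h hz, hq1] at key
  -- Peierls places the pinched functional below for z ≥ 1 and above for z ≤ 1; touching from either
  -- side suffices.
  · rcases le_total 1 z with hz1 | hz1
    · left
      filter_upwards [hev, hqd.continuousAt.eventually (lt_mem_nhds (hT.trans_eq hq1.symm))]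
        with y hy hy0
      exact Real.log_le_log hy0 (pinchedTr_le hρ hσ hy hz1)
    · right
      filter_upwards [hev] with y hy
      exact Real.log_le_log (sandwichTr_pos hρ hσ hne y hz) (le_pinchedTr hρ hσ hy hz hz1)

end

section

open Matrix Set

/-! ### The divergences -/

variable {ρ σ : Matrix n n ℂ}

lemma Q_of_finite {α : ℝ} (z : ℝ) (h : α ≤ 1 ∨ supp ρ ≤ supp σ) :
    Q α z ρ σ = ENNReal.ofReal (sandwichTr α z ρ σ) := by
  rw [Q, if_pos h]
  rfl

lemma Q_of_top {α : ℝ} (z : ℝ) (hα : 1 < α) (h : ¬ supp ρ ≤ supp σ) : Q α z ρ σ = ⊤ := by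
  rw [Q, if_neg (not_or.2 ⟨not_le.2 hα, h⟩)]

/-- Rules out the product 0 * ∞ when one factor of the log-convexity bound is infinite. -/
lemma Q_ne_zero (hρ : ρ.PosSemidef) (hσ : σ.PosSemidef) (h : supp ρ * supp σ ≠ 0) (α : ℝ)
    {z : ℝ} (hz : 0 < z) : Q α z ρ σ ≠ 0 := by
  by_cases hf : α ≤ 1 ∨ supp ρ ≤ supp σ
  · rw [Q_of_finite z hf]
    exact (ENNReal.ofReal_pos.2 (sandwichTr_pos hρ hσ h α hz)).ne'
  · rw [not_or, not_le] at hf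
    rw [Q_of_top z hf.1 hf.2]
    exact ENNReal.top_ne_zero

lemma Q_le_rpow_mul_rpow (hρ : ρ.PosSemidef) (hσ : σ.PosSemidef) (h : supp ρ * supp σ ≠ 0) {z : ℝ}
    (hz : 0 < z) (a b : ℝ) {θ : ℝ} (h0 : 0 < θ) (h1 : θ < 1) :
    Q (θ * a + (1 - θ) * b) z ρ σ ≤ Q a z ρ σ ^ θ * Q b z ρ σ ^ (1 - θ) := by
  have h1' : 0 < 1 - θ := sub_pos.2 h1
  by_cases ha : a ≤ 1 ∨ supp ρ ≤ supp σ
  · by_cases hb : b ≤ 1 ∨ supp ρ ≤ supp σ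
    · have hm : θ * a + (1 - θ) * b ≤ 1 ∨ supp ρ ≤ supp σ := by
        rcases ha with ha | ha
        · rcases hb with hb | hb
          · left
            nlinarith
          · exact Or.inr hb
        · exact Or.inr ha
      rw [Q_of_finite z ha, Q_of_finite z hb, Q_of_finite z hm,
        ENNReal.ofReal_rpow_of_nonneg (sandwichTr_nonneg hσ a hz) h0.le,
        ENNReal.ofReal_rpow_of_nonneg (sandwichTr_nonneg hσ b hz) h1'.le,
        ← ENNReal.ofReal_mul (Real.rpow_nonneg (sandwichTr_nonneg hσ a hz) _)]
      exact ENNReal.ofReal_le_ofReal (sandwichTr_le_rpow_mul_rpow hρ hσ h hz a b h0.le h1.le)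
    · rw [not_or, not_le] at hb
      rw [Q_of_top z hb.1 hb.2, ENNReal.top_rpow_of_pos h1', ENNReal.mul_top]
      · exact le_top
      · simp [ENNReal.rpow_eq_zero_iff, Q_ne_zero hρ hσ h a hz, h0.le]
  · rw [not_or, not_le] at ha
    rw [Q_of_top z ha.1 ha.2, ENNReal.top_rpow_of_pos h0, ENNReal.top_mul]
    · exact le_top
    · simp [ENNReal.rpow_eq_zero_iff, Q_ne_zero hρ hσ h b hz, h1.le]

lemma D_one (z : ℝ) (ρ σ : Matrix n n ℂ) : D 1 z ρ σ = D₁ ρ σ := if_pos rfl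

lemma D₁_of_le (h : supp ρ ≤ supp σ) :
    D₁ ρ σ = ((reTr (ρ * (cfc Real.log ρ - cfc Real.log σ)) / reTr ρ : ℝ) : EReal) := by
  rw [D₁, umegaki, if_pos h, EReal.coe_div]

lemma D₁_of_not_le (hρ : ρ.PosSemidef) (hρ0 : ρ ≠ 0) (h : ¬ supp ρ ≤ supp σ) : D₁ ρ σ = ⊤ := by
  rw [D₁, umegaki, if_neg h]
  exact EReal.top_div_of_pos_ne_top (EReal.coe_pos.2 (reTr_pos hρ hρ0)) (EReal.coe_ne_top _)

lemma D_of_pos (hρ : ρ.PosSemidef) (hρ0 : ρ ≠ 0) {α z : ℝ} (hα : α ≠ 1)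
    (h : α ≤ 1 ∨ supp ρ ≤ supp σ) (hpos : 0 < sandwichTr α z ρ σ) :
    D α z ρ σ =
      (((Real.log (sandwichTr α z ρ σ) - Real.log (reTr ρ)) / (α - 1) : ℝ) : EReal) := by
  have hT := reTr_pos hρ hρ0
  rw [D, if_neg hα, Q_of_finite z h, ← ENNReal.ofReal_div_of_pos hT,
    ENNReal.log_ofReal_of_pos (div_pos hpos hT), Real.log_div hpos.ne' hT.ne', ← EReal.coe_mul]
  congr 1
  ring

lemma D_of_eq_zero {α z : ℝ} (hα : α < 1)
    (h : sandwichTr α z ρ σ = 0) : D α z ρ σ = ⊤ := by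
  rw [D, if_neg hα.ne, Q_of_finite z (Or.inl hα.le), h, ENNReal.ofReal_zero, ENNReal.zero_div,
    ENNReal.log_zero, EReal.coe_mul_bot_of_neg (one_div_neg.2 (sub_neg.2 hα))]

lemma D_of_top {α : ℝ} (z : ℝ) (hα : 1 < α) (h : ¬ supp ρ ≤ supp σ) : D α z ρ σ = ⊤ := by
  rw [D, if_neg hα.ne', Q_of_top z hα h, ENNReal.top_div_of_ne_top ENNReal.ofReal_ne_top,
    ENNReal.log_top, EReal.coe_mul_top_of_pos (one_div_pos.2 (sub_pos.2 hα))]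

lemma sandwichTr_eq_zero (hρ : ρ.PosSemidef) (hσ : σ.PosSemidef) (h : supp ρ * supp σ = 0)
    (α : ℝ) {z : ℝ} (hz : 0 < z) : sandwichTr α z ρ σ = 0 := by
  have h1 : sandwich α z ρ σ = 0 := by
    have e : sandwich α z ρ σ = matPow ρ (α / (2 * z)) * (supp ρ * supp σ) *
        matPow σ ((1 - α) / z) * matPow ρ (α / (2 * z)) := by
      rw [← Matrix.mul_assoc, supp, supp, matPow_mul_matPow hρ, add_zero,
        Matrix.mul_assoc (matPow ρ _), matPow_mul_matPow hσ, zero_add, sandwich]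
    rw [e, h]
    simp
  rw [sandwichTr, h1, reTr_matPow isHermitian_zero hz]
  have h2 : (isHermitian_zero (n := n) (α := ℂ)).eigenvalues = 0 :=
    (IsHermitian.eigenvalues_eq_zero_iff _).2 rfl
  simp [h2, Real.zero_rpow hz.ne']

lemma D_mono_of_le (hρ : ρ.PosSemidef) (hσ : σ.PosSemidef) (hρ0 : ρ ≠ 0) (h : supp ρ ≤ supp σ)
    {z : ℝ} (hz : 0 < z) {a b : ℝ} (hab : a ≤ b) : D a z ρ σ ≤ D b z ρ σ := by
  have hne : supp ρ * supp σ ≠ 0 := by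
    rw [supp_mul_supp_of_le hρ hσ h]
    exact fun h0 => hρ0 (supp_eq_zero hρ h0)
  have hpos := fun α => sandwichTr_pos hρ hσ hne α hz
  have hD := fun (α : ℝ) (hα : α ≠ 1) => D_of_pos hρ hρ0 hα (Or.inr h) (hpos α)
  have htan := log_sandwichTr_ge hρ hσ hρ0 h hz
  by_cases ha : a = 1
  · by_cases hb : b = 1
    · rw [ha, hb]
    · subst ha
      have hb1 : 0 < b - 1 := sub_pos.2 (lt_of_le_of_ne hab (Ne.symm hb))
      rw [D_one, D₁_of_le h, hD b hb, EReal.coe_le_coe_iff, le_div_iff₀ hb1]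
      linarith [htan b]
  · by_cases hb : b = 1
    · subst hb
      have ha1 : a - 1 < 0 := sub_neg.2 (lt_of_le_of_ne hab ha)
      rw [D_one, D₁_of_le h, hD a ha, EReal.coe_le_coe_iff, div_le_iff_of_neg ha1]
      linarith [htan a]
    · rw [hD a ha, hD b hb, EReal.coe_le_coe_iff, ← sandwichTr_one hρ hσ h hz]
      exact (convexOn_log_sandwichTr hρ hσ hne hz).secant_mono (mem_univ 1) (mem_univ a)
        (mem_univ b) ha hb hab

lemma D_mono_of_not_le (hρ : ρ.PosSemidef) (hσ : σ.PosSemidef) (hρ0 : ρ ≠ 0)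
    (h : ¬ supp ρ ≤ supp σ) {z : ℝ} (hz : 0 < z) {a b : ℝ} (hab : a ≤ b) :
    D a z ρ σ ≤ D b z ρ σ := by
  rcases lt_trichotomy b 1 with hb | rfl | hb
  · have ha : a < 1 := hab.trans_lt hb
    by_cases hne : supp ρ * supp σ = 0
    · rw [D_of_eq_zero hb (sandwichTr_eq_zero hρ hσ hne b hz)]
      exact le_top
    have hpos := fun α => sandwichTr_pos hρ hσ hne α hz
    rw [D_of_pos hρ hρ0 ha.ne (Or.inl ha.le) (hpos a),
      D_of_pos hρ hρ0 hb.ne (Or.inl hb.le) (hpos b), EReal.coe_le_coe_iff]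
    have hs := (convexOn_log_sandwichTr hρ hσ hne hz).secant_mono (mem_univ 1) (mem_univ a)
      (mem_univ b) ha.ne hb.ne hab
    have h1 := Real.log_le_log (hpos 1) (sandwichTr_one_le hρ hσ hz)
    -- The numerator is nonpositive because Tr S_1^z ≤ Tr ρ, and 1 / (α - 1) decreases on α < 1, so
    -- this correction to the secant slope is non-decreasing.
    have h2 : (Real.log (sandwichTr 1 z ρ σ) - Real.log (reTr ρ)) / (a - 1) ≤
        (Real.log (sandwichTr 1 z ρ σ) - Real.log (reTr ρ)) / (b - 1) := by
      rw [div_eq_mul_one_div, div_eq_mul_one_div _ (b - 1)]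
      exact mul_le_mul_of_nonpos_left
        ((one_div_le_one_div_of_neg (by linarith) (by linarith)).2 (by linarith)) (by linarith)
    have h3 : ∀ x c : ℝ, (x - Real.log (reTr ρ)) / c =
        (x - Real.log (sandwichTr 1 z ρ σ)) / c +
          (Real.log (sandwichTr 1 z ρ σ) - Real.log (reTr ρ)) / c := fun x c => by ring
    rw [h3 _ (a - 1), h3 _ (b - 1)]
    exact add_le_add hs h2
  · rw [D_one, D₁_of_not_le hρ hρ0 h]
    exact le_top
  · rw [D_of_top z hb h]
    exact le_top

lemma monotone_D (hρ : ρ.PosSemidef) (hσ : σ.PosSemidef) (hρ0 : ρ ≠ 0) {z : ℝ} (hz : 0 < z) :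
    Monotone fun α => D α z ρ σ := fun a b hab => by
  by_cases h : supp ρ ≤ supp σ
  · exact D_mono_of_le hρ hσ hρ0 h hz hab
  · exact D_mono_of_not_le hρ hσ hρ0 h hz hab

end

end AlphaZ

end

theorem theorem3p1 {n : Type*} [Fintype n] [DecidableEq n] (ρ σ : Matrix n n ℂ)
    (hρ : ρ.PosSemidef) (hσ : σ.PosSemidef) (hρ0 : ρ ≠ 0) :
    (AlphaZ.supp ρ * AlphaZ.supp σ ≠ 0 →
      ∀ z : ℝ, 0 < z → ∀ α₁ α₂ : ℝ, 0 ≤ α₁ → 0 ≤ α₂ → ∀ θ : ℝ, 0 < θ → θ < 1 →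
        AlphaZ.Q (θ * α₁ + (1 - θ) * α₂) z ρ σ ≤
          AlphaZ.Q α₁ z ρ σ ^ θ * AlphaZ.Q α₂ z ρ σ ^ (1 - θ)) ∧
    (∀ z : ℝ, 0 < z →
      MonotoneOn (fun α : ℝ => AlphaZ.D α z ρ σ) (Set.Ici 0) ∧
      ∀ α α' : ℝ, 0 ≤ α → α < 1 → 1 < α' →
        AlphaZ.D α z ρ σ ≤ AlphaZ.D₁ ρ σ ∧ AlphaZ.D₁ ρ σ ≤ AlphaZ.D α' z ρ σ) := by
  refine ⟨fun h z hz a b _ _ θ h0 h1 => AlphaZ.Q_le_rpow_mul_rpow hρ hσ h hz a b h0 h1,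
    fun z hz => ?_⟩
  have hmono := AlphaZ.monotone_D hρ hσ hρ0 hz
  refine ⟨hmono.monotoneOn _, fun a b _ ha hb => ?_⟩
  rw [← AlphaZ.D_one z]
  exact ⟨hmono ha.le, hmono hb.le⟩
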